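/- Let $\mathbf R^4_1$ be $\mathbf R^4$ with $\langle x,y\rangle=-x_0y_0+x_1y_1+x_2y_2+x_3y_3$, and let $S^3_1=\{x\,;\,\langle x,x\rangle=1\}$ be de Sitter $3$-space. Definitions. The standard double cone is $\mathcal C^2_2=\{(a_1,a_2,a_3)\in\mathbf R^3\,;\,a_1^2+a_2^2=a_3^2\}$. A map on an open subset $U$ of $\mathcal C^2_2$ is real analytic if it is the restriction of a real analytic map on an open set $\Omega\subset\mathbf R^3$ with $\Omega\cap\mathcal C^2_2=U$. A $2$-dimensional real analytic DC-manifold is a locally compact, second countable Hausdorff space $X$ with an atlas of homeomorphisms from open subsets of $X$ onto connected open subsets of $\mathcal C^2_2$ whose transition maps are real analytic. Its DC-points are the points sent to the vertex $\mathbf 0$ by a chart. A map $f:X\to N$ into a real analytic $n$-manifold ($n\ge 3$) is DC-analytic if it is real analytic in the charts. It is a DC-immersion if, moreover, every $p\in X$ has a compatible chart $(U,\phi)$, and $f(p)$ has a real analytic coordinate system $\Phi$ of $N$, with $\Phi\circ f\circ\phi^{-1}(a)=(a,0,\dots,0)$ for $a\in\phi(U)$. A DC-immersion $f:X\to S^3_1$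 of a connected $X$ is called a space-like CMC-1 DC-immersion if the set $O$ of non-DC-points at which the metric induced by $f$ is nondegenerate is open and dense in $X$, the induced metric is positive definite on $O$, and $f|_O$ has mean curvature $1$ with respect to a suitable continuous unit normal field along $f|_O$. A nonempty $S\subset N$ is analytically complete if every real analytic $\Gamma:[0,1]\to N$ with $\Gamma([0,\varepsilon))\subset S$ for some $\varepsilon\in(0,1)$ satisfies $\Gamma([0,1])\subset S$. A DC-analytic map $f_2:X\to N$ is an analytic extension of a real analytic map $f_1:\mathbf R^2\to N$ if $f_1=f_2\circ\phi$ for some real analytic $\phi:\mathbf R^2\to X$ and $f_1(\mathbf R^2)$ is a proper subset of $f_2(X)$. Statement. Let $\nu>0$ and put $$x_1(\theta)=\frac{(\nu^2-1)\cos\theta\sinh\nu\theta}{2\nu}+\sin\theta\cosh\nu\theta,\qquad x_2(\theta)=\frac{(\nu^2-1)\sin\theta\sinh\nu\theta}{2\nu}-\cos\theta\cosh\nu\theta.$$ The G-catenoid of type SH is the map $f^\nu_{\mathrm{SH}}:\mathbf R^2\to S^3_1$, $$f^\nu_{\mathrm{SH}}(s,\theta)=\Big(\tfrac{\nu^2+1}{2\nu}\cosh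 s\,\sinh\nu\theta,\;x_1(\theta),\;x_2(\theta),\;\tfrac{\nu^2+1}{2\nu}\sinh s\,\sinh\nu\theta\Big).$$ Let $$\mathcal X^\nu_{\mathrm{SH}}=\Big\{(\xi,\eta,\theta)\in\mathbf R^3\,;\,\xi\eta=\Big(\frac{(\nu^2+1)\sinh\nu\theta}{2\nu}\Big)^2\Big\},\qquad \tilde f^\nu_{\mathrm{SH}}(\xi,\eta,\theta)=\Big(\frac{\xi+\eta}2,\;x_1(\theta),\;x_2(\theta),\;\frac{\xi-\eta}2\Big)\in S^3_1 .$$ Then $\mathcal X^\nu_{\mathrm{SH}}$, with the subspace topology, has a structure of a $2$-dimensional real analytic DC-manifold for which the inclusion into $\mathbf R^3$ is a real analytic DC-immersion and whose only DC-point is $(0,0,0)$, and with respect to this structure $\tilde f^\nu_{\mathrm{SH}}:\mathcal X^\nu_{\mathrm{SH}}\to S^3_1$ is a real analytic space-like CMC-1 DC-immersion and an analytic extension of $f^\nu_{\mathrm{SH}}$. The map $\tilde f^\nu_{\mathrm{SH}}$ is proper, and its image is analytically complete in $S^3_1$. -/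

import Mathlib

noncomputable section

/-! ## Double-cone manifolds -/

/-- The `m`-dimensional standard double cone `x₁² + ⋯ + x_m² = x_{m+1}²` in `ℝ^{m+1}`. -/
def doubleCone (m : ℕ) : Set (EuclideanSpace ℝ (Fin (m + 1))) :=
  {x | ∑ i : Fin m, (x i.castSucc) ^ 2 = (x (Fin.last m)) ^ 2}

/-- A map on an open subset `U` of the double cone is real analytic if there are an open `Ω` in
`ℝ^{m+1}` with `Ω ∩ (cone) = U` and a real analytic map on `Ω` that restricts to it on `U`. -/
def IsAnalyticOnCone {m k : ℕ} (U : Set (doubleCone m))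
    (μ : doubleCone m → EuclideanSpace ℝ (Fin k)) : Prop :=
  ∃ Ω : Set (EuclideanSpace ℝ (Fin (m + 1))), IsOpen Ω ∧ Subtype.val ⁻¹' Ω = U ∧
    ∃ μ' : EuclideanSpace ℝ (Fin (m + 1)) → EuclideanSpace ℝ (Fin k),
      AnalyticOnNhd ℝ μ' Ω ∧ ∀ a ∈ U, μ' (a : EuclideanSpace ℝ (Fin (m + 1))) = μ a

/-- A chart with values in the double cone, read as a map into `ℝ^{m+1}`. -/
def coneCoord {m : ℕ} {X : Type*} [TopologicalSpace X]
    (φ : OpenPartialHomeomorph X (doubleCone m)) (p : X) : EuclideanSpace ℝ (Fin (m + 1)) :=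
  (φ p : EuclideanSpace ℝ (Fin (m + 1)))

/-- The transition map `φ₂ ∘ φ₁⁻¹ : φ₁(U₁ ∩ U₂) → φ₂(U₁ ∩ U₂)` is real analytic. -/
def IsAnalyticTransition {m : ℕ} {X : Type*} [TopologicalSpace X]
    (φ₁ φ₂ : OpenPartialHomeomorph X (doubleCone m)) : Prop :=
  IsAnalyticOnCone (φ₁.symm.trans φ₂).source (fun a => coneCoord φ₂ (φ₁.symm a))

/-- The structure of an `m`-dimensional real analytic double-cone manifold on `X`. -/
structure DCStructure (m : ℕ) (X : Type*) [TopologicalSpace X] where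
  two_le : 2 ≤ m
  t2 : T2Space X
  locallyCompact : LocallyCompactSpace X
  secondCountable : SecondCountableTopology X
  charts : Set (OpenPartialHomeomorph X (doubleCone m))
  cover : ∀ p : X, ∃ φ ∈ charts, p ∈ φ.source
  connected_target : ∀ φ ∈ charts, IsConnected φ.target
  compatible : ∀ φ₁ ∈ charts, ∀ φ₂ ∈ charts, IsAnalyticTransition φ₁ φ₂

namespace DCStructure

variable {m : ℕ} {X : Type*} [TopologicalSpace X]

/-- Local DC-coordinate systems. -/
def IsDCCoordinate (𝒜 : DCStructure m X) (ψ : OpenPartialHomeomorph X (doubleCone m)) : Prop :=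
  ∀ φ ∈ 𝒜.charts, IsAnalyticTransition ψ φ ∧ IsAnalyticTransition φ ψ

/-- The set `Σ` of DC-points. -/
def dcPoints (𝒜 : DCStructure m X) : Set X :=
  {p | ∃ φ ∈ 𝒜.charts, p ∈ φ.source ∧ coneCoord φ p = 0}

end DCStructure

/-! ## DC-immersions into embedded real analytic submanifolds -/

/-- A real analytic diffeomorphism from a relatively open subset `M ∩ dom` of an embedded real
analytic submanifold `M ⊆ ℝ^N` onto an open subset `cod` of `ℝ^n`. -/
structure SubmanifoldDiffeo {N : ℕ} (M : Set (EuclideanSpace ℝ (Fin N))) (n : ℕ) where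
  dom : Set (EuclideanSpace ℝ (Fin N))
  cod : Set (EuclideanSpace ℝ (Fin n))
  toFun : EuclideanSpace ℝ (Fin N) → EuclideanSpace ℝ (Fin n)
  invFun : EuclideanSpace ℝ (Fin n) → EuclideanSpace ℝ (Fin N)
  isOpen_dom : IsOpen dom
  isOpen_cod : IsOpen cod
  analytic_toFun : AnalyticOnNhd ℝ toFun dom
  analytic_invFun : AnalyticOnNhd ℝ invFun cod
  mapsTo_toFun : Set.MapsTo toFun (M ∩ dom) cod
  mapsTo_invFun : Set.MapsTo invFun cod (M ∩ dom)
  leftInv : ∀ x ∈ M ∩ dom, invFun (toFun x) = x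
  rightInv : ∀ y ∈ cod, toFun (invFun y) = y

/-- `a ↦ (a, 0, …, 0)`. -/
def padZero {k n : ℕ} (a : EuclideanSpace ℝ (Fin k)) : EuclideanSpace ℝ (Fin n) :=
  WithLp.toLp 2 (fun i : Fin n => if h : (i : ℕ) < k then a ⟨i, h⟩ else 0)

namespace DCStructure

variable {m N : ℕ} {X : Type*} [TopologicalSpace X] {M : Set (EuclideanSpace ℝ (Fin N))}

/-- `f : X → M` is DC-analytic. -/
def IsDCAnalytic (𝒜 : DCStructure m X) (f : X → M) : Prop :=
  ∀ φ ∈ 𝒜.charts,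
    IsAnalyticOnCone φ.target (fun a => (f (φ.symm a) : EuclideanSpace ℝ (Fin N)))

/-- `p` is a DC-regular point of `f : X → M`, where `M` has dimension `n`: in a DC-coordinate
system `ψ` at `p` and suitable local coordinates of `M` at `f p`, `f` reads `a ↦ (a, 0)`. -/
def IsDCRegularPoint (𝒜 : DCStructure m X) (n : ℕ) (f : X → M) (p : X) : Prop :=
  ∃ ψ : OpenPartialHomeomorph X (doubleCone m), 𝒜.IsDCCoordinate ψ ∧ p ∈ ψ.source ∧
    ∃ Φ : SubmanifoldDiffeo M n, ∀ b ∈ ψ.source,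
      (f b : EuclideanSpace ℝ (Fin N)) ∈ Φ.dom ∧
        Φ.toFun (f b : EuclideanSpace ℝ (Fin N)) = padZero (coneCoord ψ b)

/-- `f : X → M` is a real analytic DC-immersion into the `n`-dimensional submanifold `M`. -/
def IsDCImmersion (𝒜 : DCStructure m X) (n : ℕ) (f : X → M) : Prop :=
  m < n ∧ 𝒜.IsDCAnalytic f ∧ ∀ p, 𝒜.IsDCRegularPoint n f p

/-- `σ` is a DC-analytic map into `X` from the open subset `W` of `ℝᵏ`, an ordinary manifold. -/
def IsAnalyticInto {k : ℕ} (𝒜 : DCStructure m X) (W : Set (EuclideanSpace ℝ (Fin k)))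
    (σ : EuclideanSpace ℝ (Fin k) → X) : Prop :=
  IsOpen W ∧ ContinuousOn σ W ∧ ∀ φ ∈ 𝒜.charts,
    AnalyticOnNhd ℝ (fun w => coneCoord φ (σ w)) (W ∩ σ ⁻¹' φ.source)

/-- `σ : W → X ∖ Σ` is an analytic immersion of an open subset `W` of `ℝᵐ`, hence, after
shrinking `W`, a local parametrization of the `m`-manifold `X ∖ Σ`. -/
def IsLocalParam (𝒜 : DCStructure m X) (W : Set (EuclideanSpace ℝ (Fin m)))
    (σ : EuclideanSpace ℝ (Fin m) → X) : Prop :=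
  𝒜.IsAnalyticInto W σ ∧ Set.MapsTo σ W 𝒜.dcPointsᶜ ∧
    ∀ φ ∈ 𝒜.charts, ∀ w ∈ W ∩ σ ⁻¹' φ.source,
      Function.Injective (fderiv ℝ (fun w => coneCoord φ (σ w)) w)

/-- `f₂ : X → M` is an analytic extension of the real analytic map `f₁ : ℝᵐ → M`. -/
def IsAnalyticExtension (𝒜 : DCStructure m X) (f₂ : X → M)
    (f₁ : EuclideanSpace ℝ (Fin m) → M) : Prop :=
  AnalyticOnNhd ℝ (fun w => (f₁ w : EuclideanSpace ℝ (Fin N))) Set.univ ∧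
    𝒜.IsDCAnalytic f₂ ∧
    (∃ φ : EuclideanSpace ℝ (Fin m) → X, 𝒜.IsAnalyticInto Set.univ φ ∧ f₁ = f₂ ∘ φ) ∧
    Set.range f₁ ⊂ Set.range f₂

end DCStructure

/-- A nonempty subset `S` of the embedded real analytic submanifold `M` is analytically complete
if every real analytic `Γ : [0,1] → M` with `Γ([0,ε)) ⊆ S` for some `ε ∈ (0,1)` stays in `S`. -/
def IsAnalyticallyComplete {N : ℕ} {M : Set (EuclideanSpace ℝ (Fin N))} (S : Set M) : Prop :=
  S.Nonempty ∧ ∀ Γ : Set.Icc (0 : ℝ) 1 → M,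
    (∃ G : ℝ → EuclideanSpace ℝ (Fin N), AnalyticOn ℝ G (Set.Icc 0 1) ∧
      ∀ t : Set.Icc (0 : ℝ) 1, G (t : ℝ) = (Γ t : EuclideanSpace ℝ (Fin N))) →
    (∃ ε : ℝ, 0 < ε ∧ ε < 1 ∧ ∀ t : Set.Icc (0 : ℝ) 1, (t : ℝ) < ε → Γ t ∈ S) →
    ∀ t, Γ t ∈ S

/-! ## De Sitter space and surfaces of constant mean curvature one -/

/-- The Lorentzian inner product of signature `(-+++)`. -/
def lorentz (x y : EuclideanSpace ℝ (Fin 4)) : ℝ :=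
  -(x 0 * y 0) + x 1 * y 1 + x 2 * y 2 + x 3 * y 3

/-- De Sitter 3-space. -/
def deSitter : Set (EuclideanSpace ℝ (Fin 4)) := {x | lorentz x x = 1}

/-- The partial derivative `∂ᵢ F`. -/
def partialDeriv (i : Fin 2) (F : EuclideanSpace ℝ (Fin 2) → EuclideanSpace ℝ (Fin 4))
    (w : EuclideanSpace ℝ (Fin 2)) : EuclideanSpace ℝ (Fin 4) :=
  fderiv ℝ F w (EuclideanSpace.single i 1)

/-- The coefficients of the first fundamental form. -/
def firstFF (F : EuclideanSpace ℝ (Fin 2) → EuclideanSpace ℝ (Fin 4))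
    (w : EuclideanSpace ℝ (Fin 2)) (i j : Fin 2) : ℝ :=
  lorentz (partialDeriv i F w) (partialDeriv j F w)

/-- The determinant of the first fundamental form. -/
def firstFFDet (F : EuclideanSpace ℝ (Fin 2) → EuclideanSpace ℝ (Fin 4))
    (w : EuclideanSpace ℝ (Fin 2)) : ℝ :=
  firstFF F w 0 0 * firstFF F w 1 1 - firstFF F w 0 1 ^ 2

/-- The coefficients of the second fundamental form with respect to the normal vector `n`. -/
def secondFF (F : EuclideanSpace ℝ (Fin 2) → EuclideanSpace ℝ (Fin 4))
    (n : EuclideanSpace ℝ (Fin 4)) (w : EuclideanSpace ℝ (Fin 2)) (i j : Fin 2) : ℝ :=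
  lorentz (partialDeriv i (partialDeriv j F) w) n

/-- The mean curvature (half the trace of the second fundamental form with respect to the
first) in the direction of the unit normal vector `n`. -/
def meanCurvature (F : EuclideanSpace ℝ (Fin 2) → EuclideanSpace ℝ (Fin 4))
    (n : EuclideanSpace ℝ (Fin 4)) (w : EuclideanSpace ℝ (Fin 2)) : ℝ :=
  (firstFF F w 0 0 * secondFF F n w 1 1 - 2 * firstFF F w 0 1 * secondFF F n w 0 1
    + firstFF F w 1 1 * secondFF F n w 0 0) / (2 * firstFFDet F w)

/-- `n` is a time-like unit vector, tangent to de Sitter space and normal to the surface `F`. -/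
def IsUnitNormal (F : EuclideanSpace ℝ (Fin 2) → EuclideanSpace ℝ (Fin 4))
    (n : EuclideanSpace ℝ (Fin 4)) (w : EuclideanSpace ℝ (Fin 2)) : Prop :=
  lorentz n n = -1 ∧ lorentz n (F w) = 0 ∧ ∀ i, lorentz n (partialDeriv i F w) = 0

namespace DCStructure

variable {X : Type*} [TopologicalSpace X]

/-- A map into de Sitter space, read in a parametrization. -/
def pullback (f : X → deSitter) (σ : EuclideanSpace ℝ (Fin 2) → X)
    (w : EuclideanSpace ℝ (Fin 2)) : EuclideanSpace ℝ (Fin 4) :=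
  (f (σ w) : EuclideanSpace ℝ (Fin 4))

/-- The set of non-DC-points at which the induced metric is nondegenerate, that is, at which `f`
is not light-like. -/
def nondegeneratePoints (𝒜 : DCStructure 2 X) (f : X → deSitter) : Set X :=
  {p | ∃ W σ, 𝒜.IsLocalParam W σ ∧ ∃ w ∈ W, σ w = p ∧ firstFFDet (pullback f σ) w ≠ 0}

/-- On the open set `O` of non-DC-points, `f` is a space-like immersion of constant mean
curvature one with respect to a continuous unit normal field `n`. -/
def IsSpacelikeCMC1On (𝒜 : DCStructure 2 X) (f : X → deSitter) (O : Set X) : Prop :=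
  IsOpen O ∧ O ⊆ 𝒜.dcPointsᶜ ∧
    ∃ n : X → EuclideanSpace ℝ (Fin 4), ContinuousOn n O ∧
      ∀ p ∈ O, ∃ W σ, 𝒜.IsLocalParam W σ ∧ ∃ w ∈ W, σ w = p ∧
        0 < firstFF (pullback f σ) w 0 0 ∧ 0 < firstFFDet (pullback f σ) w ∧
        IsUnitNormal (pullback f σ) (n p) w ∧ meanCurvature (pullback f σ) (n p) w = 1

/-- `f` is a real analytic space-like CMC-1 DC-immersion of the connected DC-manifold `X`: the
non-DC-points where the induced metric is nondegenerate are dense, and there, where mean curvature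
makes sense, `f` is a space-like immersion of constant mean curvature one. -/
def IsSpacelikeCMC1DCImmersion (𝒜 : DCStructure 2 X) (f : X → deSitter) : Prop :=
  ConnectedSpace X ∧ 𝒜.IsDCImmersion 3 f ∧ Dense (𝒜.nondegeneratePoints f) ∧
    𝒜.IsSpacelikeCMC1On f (𝒜.nondegeneratePoints f)

end DCStructure

/-! ## The G-catenoids of type SH -/

/-- The function `(ν² + 1) sinh(νθ) / (2ν)`. -/
def profileSH₀ (ν θ : ℝ) : ℝ := (ν ^ 2 + 1) * Real.sinh (ν * θ) / (2 * ν)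

/-- The function `x₁(θ)`. -/
def profileSH₁ (ν θ : ℝ) : ℝ :=
  (ν ^ 2 - 1) * Real.cos θ * Real.sinh (ν * θ) / (2 * ν) + Real.sin θ * Real.cosh (ν * θ)

/-- The function `x₂(θ)`. -/
def profileSH₂ (ν θ : ℝ) : ℝ :=
  (ν ^ 2 - 1) * Real.sin θ * Real.sinh (ν * θ) / (2 * ν) - Real.cos θ * Real.cosh (ν * θ)

theorem profileSH_sq (ν θ : ℝ) :
    profileSH₁ ν θ ^ 2 + profileSH₂ ν θ ^ 2 = 1 + profileSH₀ ν θ ^ 2 := by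
  unfold profileSH₀ profileSH₁ profileSH₂
  have h1 := Real.sin_sq_add_cos_sq θ
  have h2 := Real.cosh_sq (ν * θ)
  by_cases hν : ν = 0
  · subst hν
    simp
  · have h : ((ν ^ 2 - 1) * Real.cos θ * Real.sinh (ν * θ) / (2 * ν)
          + Real.sin θ * Real.cosh (ν * θ)) ^ 2
        + ((ν ^ 2 - 1) * Real.sin θ * Real.sinh (ν * θ) / (2 * ν)
          - Real.cos θ * Real.cosh (ν * θ)) ^ 2
        = (Real.sin θ ^ 2 + Real.cos θ ^ 2) *
          (((ν ^ 2 - 1) * Real.sinh (ν * θ) / (2 * ν)) ^ 2 + Real.cosh (ν * θ) ^ 2) := by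
      ring
    rw [h, h1, h2]
    field_simp
    ring

/-- The G-catenoid `f_SH^ν : ℝ² → S³₁` of type SH, in the coordinates `(s, θ)`. -/
def fSH (ν : ℝ) (w : EuclideanSpace ℝ (Fin 2)) : deSitter :=
  ⟨!₂[Real.cosh (w 0) * profileSH₀ ν (w 1), profileSH₁ ν (w 1), profileSH₂ ν (w 1),
      Real.sinh (w 0) * profileSH₀ ν (w 1)], by
    have h1 := profileSH_sq ν (w 1)
    have h2 := Real.cosh_sq (w 0)
    simp only [deSitter, lorentz, Set.mem_ofPred_eq, Matrix.cons_val]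
    linear_combination h1 - profileSH₀ ν (w 1) ^ 2 * h2⟩

/-- The set `X_SH^ν` of all `(ξ, η, θ)` with `ξη = ((ν² + 1) sinh(νθ) / (2ν))²`. -/
def XSH (ν : ℝ) : Set (EuclideanSpace ℝ (Fin 3)) :=
  {x | x 0 * x 1 = ((ν ^ 2 + 1) * Real.sinh (ν * x 2) / (2 * ν)) ^ 2}

/-- The map `(ξ, η, θ) ↦ ((ξ + η)/2, x₁(θ), x₂(θ), (ξ - η)/2)` from `X_SH^ν` to `S³₁`. -/
def fSHTilde (ν : ℝ) (x : XSH ν) : deSitter :=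
  ⟨!₂[(x.1 0 + x.1 1) / 2, profileSH₁ ν (x.1 2), profileSH₂ ν (x.1 2),
      (x.1 0 - x.1 1) / 2], by
    have h1 := profileSH_sq ν (x.1 2)
    have h2 : x.1 0 * x.1 1 = profileSH₀ ν (x.1 2) ^ 2 := x.2
    simp only [deSitter, lorentz, Set.mem_ofPred_eq, Matrix.cons_val]
    linear_combination h1 - h2⟩

/-- The inclusion of `X_SH^ν` into `ℝ³`. -/
def inclSH (ν : ℝ) (x : XSH ν) : (Set.univ : Set (EuclideanSpace ℝ (Fin 3))) :=
  ⟨x.1, Set.mem_univ _⟩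

end

open Set Filter Topology

/-! ### Analyticity in Euclidean coordinates -/

/-! Write P for `profileSH₀ ν`. It is an analytic diffeomorphism of the line with inverse
`profileInvSH₀ ν`, so `toConeSH ν` is an analytic diffeomorphism of ℝ³ that turns ξη = P(θ)² into
a₀² + a₁² = a₂². A single global chart therefore gives the DC-structure, the immersion property of
the inclusion, the DC-point and connectedness.

Off θ = 0 the surface is covered by the two parametrizations `paramSH` (ε = ±1), in which the
induced metric is P²(ds² + dθ²). Mean curvature one then reduces to ⟨f_ss + f_θθ, n⟩ = 2P², which
holds for the explicit normal `normalSH`. On θ = 0 away from the vertex one of ξ, η vanishes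
together with its differential, so the metric drops rank (`firstFFDet_pullback_eq_zero`). Hence the
nondegenerate points are exactly those with θ ≠ 0, a dense set.

The immersion property and completeness both rest on `exists_straightening`. The planar curve (x₁,
x₂)(θ) turns about the origin with nonzero angular speed, so θ can be read locally from the
direction of (x₁, x₂), and (x₃, P(θ), x₀) are coordinates of de Sitter space. The radius is fixed by
the de Sitter equation, and it agrees with that of the curve exactly when the coordinates lie on the
cone, since x₁² + x₂² = 1 + P² along the curve (`profileSH_sq`).

For completeness, properness makes the image closed and lets preimages along the path accumulate at
a point p when an exit time is approached. In straightened coordinates at p the cone equation along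
the path is an analytic function with accumulating zeros, so it vanishes identically nearby and the
path cannot leave. -/

theorem analyticAt_euclidean {E : Type*} [NormedAddCommGroup E] [NormedSpace ℝ E] {n : ℕ}
    {f : E → EuclideanSpace ℝ (Fin n)} {x : E} :
    AnalyticAt ℝ f x ↔ ∀ i, AnalyticAt ℝ (fun y => f y i) x := by
  constructor
  · intro h i
    exact ((EuclideanSpace.proj (𝕜 := ℝ) i).analyticAt _).comp h
  · intro h
    have h' : AnalyticAt ℝ (fun y => (fun i => f y i : Fin n → ℝ)) x := analyticAt_pi_iff.2 h
    exact ((EuclideanSpace.equiv (Fin n) ℝ).symm.toContinuousLinearMap.analyticAt _).comp h'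

@[fun_prop]
theorem analyticAt_euclidean_apply {n : ℕ} (i : Fin n) (x : EuclideanSpace ℝ (Fin n)) :
    AnalyticAt ℝ (fun y : EuclideanSpace ℝ (Fin n) => y i) x :=
  (EuclideanSpace.proj (𝕜 := ℝ) i).analyticAt x

theorem isAnalyticOnCone_of_isOpen {m k : ℕ} {U : Set (doubleCone m)} (hU : IsOpen U)
    {μ : doubleCone m → EuclideanSpace ℝ (Fin k)}
    {μ' : EuclideanSpace ℝ (Fin (m + 1)) → EuclideanSpace ℝ (Fin k)}
    (hμ' : AnalyticOnNhd ℝ μ' univ) (h : ∀ a ∈ U, μ' a = μ a) : IsAnalyticOnCone U μ := by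
  obtain ⟨Ω, hΩ, rfl⟩ := isOpen_induced_iff.1 hU
  exact ⟨Ω, hΩ, rfl, μ', hμ'.mono (subset_univ _), h⟩

/-- The cone is star-shaped about its vertex. -/
theorem isConnected_univ_doubleCone (m : ℕ) : IsConnected (univ : Set (doubleCone m)) := by
  have hs : StarConvex ℝ 0 (doubleCone m) := by
    rw [starConvex_zero_iff]
    intro x hx a _ _
    simp only [doubleCone, mem_ofPred_eq, PiLp.smul_apply, smul_eq_mul, mul_pow] at hx ⊢
    rw [← hx, Finset.mul_sum]
  have h0 : (0 : EuclideanSpace ℝ (Fin (m + 1))) ∈ doubleCone m := by simp [doubleCone]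
  have : IsConnected (doubleCone m) := (hs.isPathConnected h0).isConnected
  have := isConnected_iff_connectedSpace.1 this
  exact isConnected_univ

/-! ### The profile functions -/

theorem profileSH₀_zero (ν : ℝ) : profileSH₀ ν 0 = 0 := by simp [profileSH₀]

/-- The inverse of `profileSH₀`. -/
noncomputable def profileInvSH₀ (ν y : ℝ) : ℝ := Real.arsinh (2 * ν * y / (ν ^ 2 + 1)) / ν

theorem profileInvSH₀_profileSH₀ {ν : ℝ} (hν : 0 < ν) (θ : ℝ) :
    profileInvSH₀ ν (profileSH₀ ν θ) = θ := by
  have h : 2 * ν * ((ν ^ 2 + 1) * Real.sinh (ν * θ) / (2 * ν)) / (ν ^ 2 + 1)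
      = Real.sinh (ν * θ) := by
    have : ν ^ 2 + 1 ≠ 0 := by positivity
    field_simp
  rw [profileInvSH₀, profileSH₀, h, Real.arsinh_sinh]
  field_simp

theorem profileSH₀_profileInvSH₀ {ν : ℝ} (hν : 0 < ν) (y : ℝ) :
    profileSH₀ ν (profileInvSH₀ ν y) = y := by
  have : ν ^ 2 + 1 ≠ 0 := by positivity
  rw [profileInvSH₀, profileSH₀, mul_div_cancel₀ _ hν.ne', Real.sinh_arsinh]
  field_simp

theorem profileSH₀_ne_zero {ν : ℝ} (hν : 0 < ν) {θ : ℝ} (hθ : θ ≠ 0) : profileSH₀ ν θ ≠ 0 := by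
  intro h
  apply hθ
  rw [← profileInvSH₀_profileSH₀ hν θ, h]
  simp [profileInvSH₀]

@[fun_prop]
theorem analyticAt_profileSH₀ (ν θ : ℝ) : AnalyticAt ℝ (profileSH₀ ν) θ := by
  unfold profileSH₀
  fun_prop

@[fun_prop]
theorem analyticAt_profileSH₁ (ν θ : ℝ) : AnalyticAt ℝ (profileSH₁ ν) θ := by
  unfold profileSH₁
  fun_prop

@[fun_prop]
theorem analyticAt_profileSH₂ (ν θ : ℝ) : AnalyticAt ℝ (profileSH₂ ν) θ := by
  unfold profileSH₂
  fun_prop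

@[fun_prop]
theorem analyticAt_profileInvSH₀ (ν y : ℝ) : AnalyticAt ℝ (profileInvSH₀ ν) y := by
  unfold profileInvSH₀
  fun_prop

/-! ### The global chart -/

/-- The map `(ξ, η, θ) ↦ ((ξ - η)/2, profileSH₀ θ, (ξ + η)/2)`, which carries `XSH` to the cone. -/
noncomputable def toConeSH (ν : ℝ) (x : EuclideanSpace ℝ (Fin 3)) : EuclideanSpace ℝ (Fin 3) :=
  !₂[(x 0 - x 1) / 2, profileSH₀ ν (x 2), (x 0 + x 1) / 2]

/-- The inverse of `toConeSH`. -/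
noncomputable def ofConeSH (ν : ℝ) (a : EuclideanSpace ℝ (Fin 3)) : EuclideanSpace ℝ (Fin 3) :=
  !₂[a 2 + a 0, a 2 - a 0, profileInvSH₀ ν (a 1)]

theorem analyticAt_toConeSH (ν : ℝ) (x : EuclideanSpace ℝ (Fin 3)) :
    AnalyticAt ℝ (toConeSH ν) x := by
  rw [analyticAt_euclidean]
  intro i
  fin_cases i <;> simp [toConeSH] <;> fun_prop

theorem analyticAt_ofConeSH (ν : ℝ) (x : EuclideanSpace ℝ (Fin 3)) :
    AnalyticAt ℝ (ofConeSH ν) x := by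
  rw [analyticAt_euclidean]
  intro i
  fin_cases i <;> simp [ofConeSH] <;> fun_prop

theorem ofConeSH_toConeSH {ν : ℝ} (hν : 0 < ν) (x : EuclideanSpace ℝ (Fin 3)) :
    ofConeSH ν (toConeSH ν x) = x := by
  ext i
  fin_cases i <;> simp [ofConeSH, toConeSH, profileInvSH₀_profileSH₀ hν] <;> ring

theorem toConeSH_ofConeSH {ν : ℝ} (hν : 0 < ν) (a : EuclideanSpace ℝ (Fin 3)) :
    toConeSH ν (ofConeSH ν a) = a := by
  ext i
  fin_cases i <;> simp [ofConeSH, toConeSH, profileSH₀_profileInvSH₀ hν]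

theorem mem_doubleCone_two {a : EuclideanSpace ℝ (Fin 3)} :
    a ∈ doubleCone 2 ↔ a 0 ^ 2 + a 1 ^ 2 = a 2 ^ 2 := by
  simp [doubleCone, Fin.sum_univ_two]

theorem mem_XSH {ν : ℝ} {x : EuclideanSpace ℝ (Fin 3)} :
    x ∈ XSH ν ↔ x 0 * x 1 = profileSH₀ ν (x 2) ^ 2 := Iff.rfl

theorem toConeSH_mem_doubleCone {ν : ℝ} {x : EuclideanSpace ℝ (Fin 3)} :
    toConeSH ν x ∈ doubleCone 2 ↔ x ∈ XSH ν := by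
  rw [mem_doubleCone_two, mem_XSH]
  simp only [toConeSH, Matrix.cons_val]
  constructor <;> intro h <;> linear_combination -h

theorem ofConeSH_mem_XSH {ν : ℝ} (hν : 0 < ν) {a : EuclideanSpace ℝ (Fin 3)}
    (ha : a ∈ doubleCone 2) : ofConeSH ν a ∈ XSH ν := by
  rwa [← toConeSH_mem_doubleCone, toConeSH_ofConeSH hν]

theorem continuous_toConeSH (ν : ℝ) : Continuous (toConeSH ν) :=
  continuous_iff_continuousAt.2 fun x => (analyticAt_toConeSH ν x).continuousAt

theorem continuous_ofConeSH (ν : ℝ) : Continuous (ofConeSH ν) :=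
  continuous_iff_continuousAt.2 fun x => (analyticAt_ofConeSH ν x).continuousAt

/-- The homeomorphism of `XSH` with the standard double cone. -/
noncomputable def coneHomeoSH {ν : ℝ} (hν : 0 < ν) : XSH ν ≃ₜ doubleCone 2 where
  toFun x := ⟨toConeSH ν x, toConeSH_mem_doubleCone.2 x.2⟩
  invFun a := ⟨ofConeSH ν a, ofConeSH_mem_XSH hν a.2⟩
  left_inv x := Subtype.ext (ofConeSH_toConeSH hν x)
  right_inv a := Subtype.ext (toConeSH_ofConeSH hν a)
  continuous_toFun := ((continuous_toConeSH ν).comp continuous_subtype_val).subtype_mk _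
  continuous_invFun := ((continuous_ofConeSH ν).comp continuous_subtype_val).subtype_mk _

/-- The global chart of `XSH`. -/
noncomputable def coneChartSH {ν : ℝ} (hν : 0 < ν) : OpenPartialHomeomorph (XSH ν) (doubleCone 2) :=
  (coneHomeoSH hν).toOpenPartialHomeomorph

theorem coneCoord_coneChartSH {ν : ℝ} (hν : 0 < ν) (x : XSH ν) :
    coneCoord (coneChartSH hν) x = toConeSH ν x := rfl

theorem isClosed_XSH (ν : ℝ) : IsClosed (XSH ν) := by
  have h : XSH ν = toConeSH ν ⁻¹' doubleCone 2 := by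
    ext x
    exact toConeSH_mem_doubleCone.symm
  rw [h]
  refine IsClosed.preimage (continuous_toConeSH ν) ?_
  have : doubleCone 2 = {a : EuclideanSpace ℝ (Fin 3) | a 0 ^ 2 + a 1 ^ 2 = a 2 ^ 2} := by
    ext a
    exact mem_doubleCone_two
  rw [this]
  exact isClosed_eq (by fun_prop) (by fun_prop)

/-- A restriction of the global chart has analytic transition maps with every other one. -/
theorem isAnalyticTransition_restr {ν : ℝ} (hν : 0 < ν) (s t : Set (XSH ν)) :
    IsAnalyticTransition ((coneChartSH hν).restr s) ((coneChartSH hν).restr t) := by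
  refine isAnalyticOnCone_of_isOpen (OpenPartialHomeomorph.open_source _)
    (μ' := id) analyticOnNhd_id ?_
  intro a _
  -- Both charts are restrictions of the same map, so the transition is the identity.
  exact (toConeSH_ofConeSH hν a).symm

theorem coneChartSH_restr_univ {ν : ℝ} (hν : 0 < ν) :
    (coneChartSH hν).restr univ = coneChartSH hν :=
  OpenPartialHomeomorph.restr_univ

/-- The DC-structure of `XSH` given by the global chart. -/
noncomputable def structureSH {ν : ℝ} (hν : 0 < ν) : DCStructure 2 (XSH ν) where
  two_le := le_rfl
  t2 := inferInstance
  locallyCompact := (isClosed_XSH ν).locallyCompactSpace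
  secondCountable := inferInstance
  charts := {coneChartSH hν}
  cover p := ⟨_, rfl, mem_univ p⟩
  connected_target := by
    rintro φ rfl
    exact isConnected_univ_doubleCone 2
  compatible := by
    rintro φ₁ rfl φ₂ rfl
    simpa only [coneChartSH_restr_univ] using isAnalyticTransition_restr hν univ univ

/-- The atlas is a singleton, but de Sitter coordinates straighten the immersion only locally; these
smaller charts serve as the DC-coordinates there. -/
theorem isDCCoordinate_restr {ν : ℝ} (hν : 0 < ν) (s : Set (XSH ν)) :
    (structureSH hν).IsDCCoordinate ((coneChartSH hν).restr s) := by
  rintro φ rfl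
  constructor
  · simpa only [coneChartSH_restr_univ] using isAnalyticTransition_restr hν s univ
  · simpa only [coneChartSH_restr_univ] using isAnalyticTransition_restr hν univ s

theorem toConeSH_eq_zero {ν : ℝ} (hν : 0 < ν) {x : EuclideanSpace ℝ (Fin 3)} :
    toConeSH ν x = 0 ↔ x = 0 := by
  have h0 : toConeSH ν 0 = 0 := by
    ext i
    fin_cases i <;> simp [toConeSH, profileSH₀_zero]
  constructor
  · intro h
    rw [← ofConeSH_toConeSH hν x, h]
    nth_rw 1 [← h0]
    exact ofConeSH_toConeSH hν 0
  · rintro rfl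
    exact h0

theorem mem_dcPoints_structureSH {ν : ℝ} (hν : 0 < ν) {p : XSH ν} :
    p ∈ (structureSH hν).dcPoints ↔ p.1 = 0 := by
  rw [← toConeSH_eq_zero hν]
  constructor
  · rintro ⟨φ, rfl, _, h⟩
    exact h
  · intro h
    exact ⟨_, rfl, mem_univ p, h⟩

theorem image_dcPoints_structureSH {ν : ℝ} (hν : 0 < ν) :
    Subtype.val '' (structureSH hν).dcPoints = {(0 : EuclideanSpace ℝ (Fin 3))} := by
  have h0 : (0 : EuclideanSpace ℝ (Fin 3)) ∈ XSH ν := by simp [mem_XSH, profileSH₀_zero]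
  ext x
  constructor
  · rintro ⟨p, hp, rfl⟩
    exact (mem_dcPoints_structureSH hν).1 hp
  · rintro rfl
    exact ⟨⟨0, h0⟩, (mem_dcPoints_structureSH hν).2 rfl, rfl⟩

theorem connectedSpace_XSH {ν : ℝ} (hν : 0 < ν) : ConnectedSpace (XSH ν) := by
  have := connectedSpace_iff_univ.2 (isConnected_univ_doubleCone 2)
  exact (coneHomeoSH hν).symm.surjective.connectedSpace (coneHomeoSH hν).symm.continuous

theorem padZero_self {n : ℕ} (a : EuclideanSpace ℝ (Fin n)) :
    (padZero a : EuclideanSpace ℝ (Fin n)) = a := by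
  ext i
  simp [padZero]

/-! ### The inclusion -/

theorem isDCImmersion_inclSH {ν : ℝ} (hν : 0 < ν) :
    (structureSH hν).IsDCImmersion 3 (inclSH ν) := by
  refine ⟨by norm_num, ?_, fun p => ⟨_, isDCCoordinate_restr hν univ, by simp [coneChartSH], ?_⟩⟩
  · rintro φ rfl
    exact isAnalyticOnCone_of_isOpen (OpenPartialHomeomorph.open_target _)
      (fun a _ => analyticAt_ofConeSH ν a) fun _ _ => rfl
  -- The chart is the restriction of an ambient diffeomorphism, and the target has dimension 3 = 2 +
  -- 1, so there are no zeros to append.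
  · refine ⟨⟨univ, univ, toConeSH ν, ofConeSH ν, isOpen_univ, isOpen_univ,
      fun x _ => analyticAt_toConeSH ν x, fun x _ => analyticAt_ofConeSH ν x, fun _ _ => mem_univ _,
      fun _ _ => ⟨mem_univ _, mem_univ _⟩, fun x _ => ofConeSH_toConeSH hν x,
      fun x _ => toConeSH_ofConeSH hν x⟩, fun b _ => ⟨mem_univ _, ?_⟩⟩
    exact (padZero_self _).symm

/-! ### The map into de Sitter space -/

/-- The formula of `fSHTilde`, on all of `ℝ³`. -/
noncomputable def ambientSH (ν : ℝ) (x : EuclideanSpace ℝ (Fin 3)) : EuclideanSpace ℝ (Fin 4) :=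
  !₂[(x 0 + x 1) / 2, profileSH₁ ν (x 2), profileSH₂ ν (x 2), (x 0 - x 1) / 2]

theorem coe_fSHTilde (ν : ℝ) (x : XSH ν) :
    (fSHTilde ν x : EuclideanSpace ℝ (Fin 4)) = ambientSH ν x := rfl

theorem analyticAt_ambientSH (ν : ℝ) (x : EuclideanSpace ℝ (Fin 3)) :
    AnalyticAt ℝ (ambientSH ν) x := by
  rw [analyticAt_euclidean]
  intro i
  fin_cases i <;> simp [ambientSH] <;> fun_prop

theorem continuous_ambientSH (ν : ℝ) : Continuous (ambientSH ν) :=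
  continuous_iff_continuousAt.2 fun x => (analyticAt_ambientSH ν x).continuousAt

theorem continuous_fSHTilde (ν : ℝ) : Continuous (fSHTilde ν) :=
  ((continuous_ambientSH ν).comp continuous_subtype_val).subtype_mk _

theorem isDCAnalytic_fSHTilde {ν : ℝ} (hν : 0 < ν) :
    (structureSH hν).IsDCAnalytic (fSHTilde ν) := by
  rintro φ rfl
  exact isAnalyticOnCone_of_isOpen (OpenPartialHomeomorph.open_target _)
    (fun a _ => (analyticAt_ambientSH ν _).comp (analyticAt_ofConeSH ν a)) fun _ _ => rfl

/-- The outer coordinates agree up to order, and `profileSH_sq` says that the remaining squares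
differ by exactly 1. -/
theorem norm_toConeSH_le (ν : ℝ) (x : EuclideanSpace ℝ (Fin 3)) :
    ‖toConeSH ν x‖ ≤ ‖ambientSH ν x‖ := by
  rw [EuclideanSpace.norm_eq, EuclideanSpace.norm_eq]
  apply Real.sqrt_le_sqrt
  simp only [Fin.sum_univ_three, Fin.sum_univ_four, toConeSH, ambientSH, Matrix.cons_val,
    Real.norm_eq_abs, sq_abs]
  linarith [profileSH_sq ν (x 2)]

/-- By the norm comparison, the preimage of a bounded set lies in the `ofConeSH`-image of a closed
ball, which is compact. -/
theorem isProperMap_ambientSH {ν : ℝ} (hν : 0 < ν) : IsProperMap (ambientSH ν) := by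
  refine isProperMap_iff_isCompact_preimage.2 ⟨continuous_ambientSH ν, fun K hK => ?_⟩
  obtain ⟨R, hR⟩ := hK.isBounded.exists_norm_le
  refine ((isCompact_closedBall (0 : EuclideanSpace ℝ (Fin 3)) R).image
    (continuous_ofConeSH ν)).of_isClosed_subset
    (hK.isClosed.preimage (continuous_ambientSH ν)) fun x hx => ?_
  refine ⟨toConeSH ν x, ?_, ofConeSH_toConeSH hν x⟩
  rw [mem_closedBall_zero_iff]
  exact (norm_toConeSH_le ν x).trans (hR _ hx)

theorem isProperMap_fSHTilde {ν : ℝ} (hν : 0 < ν) : IsProperMap (fSHTilde ν) :=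
  isProperMap_of_comp_of_inj (continuous_fSHTilde ν) continuous_subtype_val
    ((isProperMap_ambientSH hν).comp (isClosed_XSH ν).isClosedEmbedding_subtypeVal.isProperMap)
    Subtype.val_injective

/-! ### Mean curvature in separated variables -/

/-- The map `w ↦ (a_j(w₀) b_j(w₁))_j`. -/
noncomputable def separated {n : ℕ} (a b : Fin n → ℝ → ℝ) (w : EuclideanSpace ℝ (Fin 2)) :
    EuclideanSpace ℝ (Fin n) :=
  WithLp.toLp 2 fun j => a j (w 0) * b j (w 1)

/-- Both the surface and its cone coordinates are entrywise products of a function of s and a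
function of θ, a class closed under partial derivatives. -/
theorem fderiv_separated_apply {n : ℕ} {a b a' b' : Fin n → ℝ → ℝ}
    (ha : ∀ j t, HasDerivAt (a j) (a' j t) t) (hb : ∀ j t, HasDerivAt (b j) (b' j t) t)
    (w v : EuclideanSpace ℝ (Fin 2)) (j : Fin n) :
    fderiv ℝ (separated a b) w v j =
      a' j (w 0) * b j (w 1) * v 0 + a j (w 0) * b' j (w 1) * v 1 := by
  have hp : ∀ i : Fin 2, HasFDerivAt (fun w : EuclideanSpace ℝ (Fin 2) => w i)
      (EuclideanSpace.proj i : EuclideanSpace ℝ (Fin 2) →L[ℝ] ℝ) w :=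
    fun i => (EuclideanSpace.proj (𝕜 := ℝ) i).hasFDerivAt
  have hj : ∀ j, HasFDerivAt (fun w => separated a b w j)
      (a j (w 0) • (b' j (w 1) • (EuclideanSpace.proj 1 : EuclideanSpace ℝ (Fin 2) →L[ℝ] ℝ)) +
        b j (w 1) • (a' j (w 0) • (EuclideanSpace.proj 0 : EuclideanSpace ℝ (Fin 2) →L[ℝ] ℝ))) w :=
    fun j => ((ha j (w 0)).comp_hasFDerivAt w (hp 0)).mul ((hb j (w 1)).comp_hasFDerivAt w (hp 1))
  have hd : DifferentiableAt ℝ (separated a b) w :=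
    differentiableAt_euclidean.2 fun j => (hj j).differentiableAt
  have h := ((EuclideanSpace.proj (𝕜 := ℝ) j).hasFDerivAt.comp w hd.hasFDerivAt).unique (hj j)
  have h2 := congrArg (fun L => L v) h
  simp at h2
  rw [h2]
  ring

theorem partialDeriv_zero_separated {a b a' b' : Fin 4 → ℝ → ℝ}
    (ha : ∀ j t, HasDerivAt (a j) (a' j t) t) (hb : ∀ j t, HasDerivAt (b j) (b' j t) t) :
    partialDeriv 0 (separated a b) = separated a' b := by
  ext w j
  rw [partialDeriv, fderiv_separated_apply ha hb]
  simp [separated]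

theorem partialDeriv_one_separated {a b a' b' : Fin 4 → ℝ → ℝ}
    (ha : ∀ j t, HasDerivAt (a j) (a' j t) t) (hb : ∀ j t, HasDerivAt (b j) (b' j t) t) :
    partialDeriv 1 (separated a b) = separated a b' := by
  ext w j
  rw [partialDeriv, fderiv_separated_apply ha hb]
  simp [separated]

/-! ### Derivatives of the profile functions -/

theorem hasDerivAt_profileSH₀ {ν : ℝ} (hν : 0 < ν) (θ : ℝ) :
    HasDerivAt (profileSH₀ ν) ((ν ^ 2 + 1) / 2 * Real.cosh (ν * θ)) θ := by
  have h := (((hasDerivAt_id θ).const_mul ν).sinh.const_mul (ν ^ 2 + 1)).div_const (2 * ν)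
  refine HasDerivAt.congr_deriv h ?_
  simp only [id, mul_one]
  field_simp

theorem hasDerivAt_profileSH₁ {ν : ℝ} (hν : 0 < ν) (θ : ℝ) :
    HasDerivAt (profileSH₁ ν) ((ν ^ 2 + 1) / 2 *
      (Real.cos θ * Real.cosh (ν * θ) + Real.sin θ * Real.sinh (ν * θ) / ν)) θ := by
  have hl := (hasDerivAt_id θ).const_mul ν
  have h := ((((Real.hasDerivAt_cos θ).const_mul (ν ^ 2 - 1)).mul hl.sinh).div_const (2 * ν)).add
    ((Real.hasDerivAt_sin θ).mul hl.cosh)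
  refine HasDerivAt.congr_deriv h ?_
  simp only [id, mul_one]
  field_simp
  ring

theorem hasDerivAt_profileSH₂ {ν : ℝ} (hν : 0 < ν) (θ : ℝ) :
    HasDerivAt (profileSH₂ ν) ((ν ^ 2 + 1) / 2 *
      (Real.sin θ * Real.cosh (ν * θ) - Real.cos θ * Real.sinh (ν * θ) / ν)) θ := by
  have hl := (hasDerivAt_id θ).const_mul ν
  have h := ((((Real.hasDerivAt_sin θ).const_mul (ν ^ 2 - 1)).mul hl.sinh).div_const (2 * ν)).sub
    ((Real.hasDerivAt_cos θ).mul hl.cosh)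
  refine HasDerivAt.congr_deriv h ?_
  simp only [id, mul_one]
  field_simp
  ring

theorem hasDerivAt_deriv_profileSH₀ {ν : ℝ} (θ : ℝ) :
    HasDerivAt (fun θ => (ν ^ 2 + 1) / 2 * Real.cosh (ν * θ))
      (ν * (ν ^ 2 + 1) / 2 * Real.sinh (ν * θ)) θ := by
  have h := ((hasDerivAt_id θ).const_mul ν).cosh.const_mul ((ν ^ 2 + 1) / 2)
  refine HasDerivAt.congr_deriv h ?_
  simp only [id, mul_one]
  ring

/-- Together with the next lemma: the second derivative of the planar curve is a multiple of (cos θ,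
sin θ), so only the radial component u of the normal enters its pairing with the normal. -/
theorem hasDerivAt_deriv_profileSH₁ {ν : ℝ} (hν : 0 < ν) (θ : ℝ) :
    HasDerivAt (fun θ => (ν ^ 2 + 1) / 2 *
      (Real.cos θ * Real.cosh (ν * θ) + Real.sin θ * Real.sinh (ν * θ) / ν))
      ((ν ^ 2 + 1) ^ 2 / (2 * ν) * (Real.cos θ * Real.sinh (ν * θ))) θ := by
  have hl := (hasDerivAt_id θ).const_mul ν
  have h := (((Real.hasDerivAt_cos θ).mul hl.cosh).add
    (((Real.hasDerivAt_sin θ).mul hl.sinh).div_const ν)).const_mul ((ν ^ 2 + 1) / 2)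
  refine HasDerivAt.congr_deriv h ?_
  simp only [id, mul_one]
  field_simp
  ring

theorem hasDerivAt_deriv_profileSH₂ {ν : ℝ} (hν : 0 < ν) (θ : ℝ) :
    HasDerivAt (fun θ => (ν ^ 2 + 1) / 2 *
      (Real.sin θ * Real.cosh (ν * θ) - Real.cos θ * Real.sinh (ν * θ) / ν))
      ((ν ^ 2 + 1) ^ 2 / (2 * ν) * (Real.sin θ * Real.sinh (ν * θ))) θ := by
  have hl := (hasDerivAt_id θ).const_mul ν
  have h := (((Real.hasDerivAt_sin θ).mul hl.cosh).sub
    (((Real.hasDerivAt_cos θ).mul hl.sinh).div_const ν)).const_mul ((ν ^ 2 + 1) / 2)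
  refine HasDerivAt.congr_deriv h ?_
  simp only [id, mul_one]
  field_simp
  ring

/-! ### Parametrizations of the regular part -/

/-- The parametrization `(s, θ) ↦ (ε e^s profileSH₀ θ, ε e^{-s} profileSH₀ θ, θ)` for `ε² = 1`. -/
noncomputable def paramSH (ν : ℝ) {ε : ℝ} (hε : ε ^ 2 = 1) (w : EuclideanSpace ℝ (Fin 2)) : XSH ν :=
  ⟨!₂[ε * Real.exp (w 0) * profileSH₀ ν (w 1), ε * Real.exp (-w 0) * profileSH₀ ν (w 1), w 1], by
    rw [mem_XSH]
    simp only [Matrix.cons_val]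
    have h : Real.exp (w 0) * Real.exp (-w 0) = 1 := by rw [← Real.exp_add]; simp
    linear_combination profileSH₀ ν (w 1) ^ 2 * ε ^ 2 * h + profileSH₀ ν (w 1) ^ 2 * hε⟩

section
variable {ν ε : ℝ} (hν : 0 < ν) (hε : ε ^ 2 = 1)

theorem coneCoord_paramSH : (fun w => coneCoord (coneChartSH hν) (paramSH ν hε w)) =
    separated ![fun s => ε * Real.sinh s, fun _ => 1, fun s => ε * Real.cosh s]
      ![profileSH₀ ν, profileSH₀ ν, profileSH₀ ν] := by
  ext w j
  rw [coneCoord_coneChartSH]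
  fin_cases j <;> simp [toConeSH, paramSH, separated, Real.sinh_eq, Real.cosh_eq] <;> ring

theorem pullback_paramSH : DCStructure.pullback (fSHTilde ν) (paramSH ν hε) =
    separated ![fun s => ε * Real.cosh s, fun _ => 1, fun _ => 1, fun s => ε * Real.sinh s]
      ![profileSH₀ ν, profileSH₁ ν, profileSH₂ ν, profileSH₀ ν] := by
  ext w j
  rw [DCStructure.pullback, coe_fSHTilde]
  fin_cases j <;> simp [ambientSH, paramSH, separated, Real.sinh_eq, Real.cosh_eq] <;> ring

theorem isAnalyticInto_paramSH {W : Set (EuclideanSpace ℝ (Fin 2))} (hW : IsOpen W) :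
    (structureSH hν).IsAnalyticInto W (paramSH ν hε) := by
  have han : ∀ w, AnalyticAt ℝ (fun w => coneCoord (coneChartSH hν) (paramSH ν hε w)) w := by
    intro w
    rw [coneCoord_paramSH, analyticAt_euclidean]
    intro j
    fin_cases j <;> simp [separated] <;> fun_prop
  refine ⟨hW, ?_, ?_⟩
  · have hc : Continuous fun w => coneCoord (coneChartSH hν) (paramSH ν hε w) :=
      continuous_iff_continuousAt.2 fun w => (han w).continuousAt
    have hc' : Continuous fun w => coneHomeoSH hν (paramSH ν hε w) :=
      continuous_induced_rng.2 hc
    exact ((coneHomeoSH hν).comp_continuous_iff.1 hc').continuousOn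
  · rintro φ rfl w _
    exact han w

include hν in
theorem isLocalParam_paramSH :
    (structureSH hν).IsLocalParam {w | w 1 ≠ 0} (paramSH ν hε) := by
  refine ⟨isAnalyticInto_paramSH hν hε (isOpen_ne_fun (by fun_prop) (by fun_prop)), ?_, ?_⟩
  · intro w hw h
    rw [mem_dcPoints_structureSH hν] at h
    exact hw (congrArg (fun x : EuclideanSpace ℝ (Fin 3) => x 2) h)
  · rintro φ rfl w ⟨hw, _⟩
    have hε0 : ε ≠ 0 := by
      rintro rfl
      norm_num at hε
    have ha : ∀ (j : Fin 3) t, HasDerivAt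
        ((![fun s => ε * Real.sinh s, fun _ => 1, fun s => ε * Real.cosh s] : Fin 3 → ℝ → ℝ) j)
        ((![fun s => ε * Real.cosh s, fun _ => 0, fun s => ε * Real.sinh s] : Fin 3 → ℝ → ℝ) j t)
        t := by
      intro j t
      fin_cases j
      · exact (Real.hasDerivAt_sinh t).const_mul ε
      · exact hasDerivAt_const t 1
      · exact (Real.hasDerivAt_cosh t).const_mul ε
    have hb : ∀ (j : Fin 3) t, HasDerivAt
        ((![profileSH₀ ν, profileSH₀ ν, profileSH₀ ν] : Fin 3 → ℝ → ℝ) j)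
        ((fun (_ : Fin 3) θ => (ν ^ 2 + 1) / 2 * Real.cosh (ν * θ)) j t) t := by
      intro j t
      fin_cases j <;> exact hasDerivAt_profileSH₀ hν t
    rw [coneCoord_paramSH, injective_iff_map_eq_zero]
    intro v hv
    -- The middle cone coordinate depends on θ alone, with positive derivative, so it kills `v 1`;
    -- the first coordinate has s-derivative ε cosh(s) P(θ) ≠ 0, which then kills `v 0`.
    have h1 := fderiv_separated_apply ha hb w v 1
    have h0 := fderiv_separated_apply ha hb w v 0
    rw [hv] at h0 h1
    have hc := (Real.cosh_pos (ν * w 1)).ne'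
    have hc' := (Real.cosh_pos (w 0)).ne'
    have hk : ν ^ 2 + 1 ≠ 0 := by positivity
    have v1 : v 1 = 0 := by simpa [hc, hk] using h1
    have v0 : v 0 = 0 := by simpa [hc', hε0, v1, profileSH₀_ne_zero hν hw] using h0
    ext i
    fin_cases i
    · exact v0
    · exact v1

end

/-- The unit normal field along the regular part of `XSH`. -/
noncomputable def normalSH (ν : ℝ) (x : EuclideanSpace ℝ (Fin 3)) : EuclideanSpace ℝ (Fin 4) :=
  let S := Real.sinh (ν * x 2)
  let C := Real.cosh (ν * x 2)
  -- In the frame e = (cos θ, sin θ), e' = (-sin θ, cos θ) the planar curve is (ν² - 1)/(2ν) S e - C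
  -- e' and its velocity is (ν² + 1)/2 (C e - (S/ν) e'). Orthogonality to ∂_s makes the outer part
  -- of the normal a multiple c of that of f; with planar part u e + C e', the values of c and u
  -- solve the remaining normality and norm equations.
  let c := ((ν ^ 2 - 1) / (2 * ν) * S ^ 2 - ν * C ^ 2) / ((ν ^ 2 + 1) / (2 * ν) * S ^ 2)
  let u := ((ν ^ 2 + 1) / (2 * ν) * S ^ 2 - ν * C ^ 2) / S
  !₂[c * ((x 0 + x 1) / 2), u * Real.cos (x 2) - C * Real.sin (x 2),
    u * Real.sin (x 2) + C * Real.cos (x 2), c * ((x 0 - x 1) / 2)]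

theorem sinh_mul_ne_zero {ν θ : ℝ} (hν : 0 < ν) (hθ : θ ≠ 0) : Real.sinh (ν * θ) ≠ 0 := by
  rw [Ne, Real.sinh_eq_zero]
  exact mul_ne_zero hν.ne' hθ

theorem continuousOn_normalSH {ν : ℝ} (hν : 0 < ν) :
    ContinuousOn (fun x : XSH ν => normalSH ν x) {x | x.1 2 ≠ 0} := by
  intro x hx
  apply ContinuousAt.continuousWithinAt
  have hS := sinh_mul_ne_zero hν hx
  have hk : (ν ^ 2 + 1) / (2 * ν) * Real.sinh (ν * x.1 2) ^ 2 ≠ 0 := by positivity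
  refine ContinuousAt.comp (f := Subtype.val) (g := normalSH ν) ?_ continuous_subtype_val.continuousAt
  refine AnalyticAt.continuousAt (𝕜 := ℝ) (analyticAt_euclidean.2 fun i => ?_)
  fin_cases i <;> simp [normalSH] <;> fun_prop (disch := assumption)

/-! ### Fundamental forms and mean curvature of the regular part. -/

section
variable {ν ε : ℝ} (hν : 0 < ν) (hε : ε ^ 2 = 1)
include hν

theorem partialDeriv_pullback_paramSH :
    partialDeriv 0 (DCStructure.pullback (fSHTilde ν) (paramSH ν hε)) =
      separated ![fun s => ε * Real.sinh s, fun _ => 0, fun _ => 0, fun s => ε * Real.cosh s]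
        ![profileSH₀ ν, profileSH₁ ν, profileSH₂ ν, profileSH₀ ν] ∧
    partialDeriv 1 (DCStructure.pullback (fSHTilde ν) (paramSH ν hε)) =
      separated ![fun s => ε * Real.cosh s, fun _ => 1, fun _ => 1, fun s => ε * Real.sinh s]
        ![fun θ => (ν ^ 2 + 1) / 2 * Real.cosh (ν * θ),
          fun θ => (ν ^ 2 + 1) / 2 *
            (Real.cos θ * Real.cosh (ν * θ) + Real.sin θ * Real.sinh (ν * θ) / ν),
          fun θ => (ν ^ 2 + 1) / 2 *
            (Real.sin θ * Real.cosh (ν * θ) - Real.cos θ * Real.sinh (ν * θ) / ν),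
          fun θ => (ν ^ 2 + 1) / 2 * Real.cosh (ν * θ)] ∧
    partialDeriv 0 (partialDeriv 0 (DCStructure.pullback (fSHTilde ν) (paramSH ν hε))) =
      separated ![fun s => ε * Real.cosh s, fun _ => 0, fun _ => 0, fun s => ε * Real.sinh s]
        ![profileSH₀ ν, profileSH₁ ν, profileSH₂ ν, profileSH₀ ν] ∧
    partialDeriv 1 (partialDeriv 1 (DCStructure.pullback (fSHTilde ν) (paramSH ν hε))) =
      separated ![fun s => ε * Real.cosh s, fun _ => 1, fun _ => 1, fun s => ε * Real.sinh s]
        ![fun θ => ν * (ν ^ 2 + 1) / 2 * Real.sinh (ν * θ),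
          fun θ => (ν ^ 2 + 1) ^ 2 / (2 * ν) * (Real.cos θ * Real.sinh (ν * θ)),
          fun θ => (ν ^ 2 + 1) ^ 2 / (2 * ν) * (Real.sin θ * Real.sinh (ν * θ)),
          fun θ => ν * (ν ^ 2 + 1) / 2 * Real.sinh (ν * θ)] := by
  have hs : ∀ t, HasDerivAt (fun s => ε * Real.sinh s) (ε * Real.cosh t) t :=
    fun t => (Real.hasDerivAt_sinh t).const_mul ε
  have hc : ∀ t, HasDerivAt (fun s => ε * Real.cosh s) (ε * Real.sinh t) t :=
    fun t => (Real.hasDerivAt_cosh t).const_mul ε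
  have ha : ∀ (j : Fin 4) t, HasDerivAt ((![fun s => ε * Real.cosh s, fun _ => 1, fun _ => 1,
      fun s => ε * Real.sinh s] : Fin 4 → ℝ → ℝ) j)
      ((![fun s => ε * Real.sinh s, fun _ => 0, fun _ => 0,
      fun s => ε * Real.cosh s] : Fin 4 → ℝ → ℝ) j t) t := by
    intro j t
    fin_cases j
    exacts [hc t, hasDerivAt_const t 1, hasDerivAt_const t 1, hs t]
  have ha' : ∀ (j : Fin 4) t, HasDerivAt ((![fun s => ε * Real.sinh s, fun _ => 0, fun _ => 0,
      fun s => ε * Real.cosh s] : Fin 4 → ℝ → ℝ) j)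
      ((![fun s => ε * Real.cosh s, fun _ => 0, fun _ => 0,
      fun s => ε * Real.sinh s] : Fin 4 → ℝ → ℝ) j t) t := by
    intro j t
    fin_cases j
    exacts [hs t, hasDerivAt_const t 0, hasDerivAt_const t 0, hc t]
  have hb : ∀ (j : Fin 4) t, HasDerivAt
      ((![profileSH₀ ν, profileSH₁ ν, profileSH₂ ν, profileSH₀ ν] : Fin 4 → ℝ → ℝ) j)
      ((![fun θ => (ν ^ 2 + 1) / 2 * Real.cosh (ν * θ),
          fun θ => (ν ^ 2 + 1) / 2 *
            (Real.cos θ * Real.cosh (ν * θ) + Real.sin θ * Real.sinh (ν * θ) / ν),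
          fun θ => (ν ^ 2 + 1) / 2 *
            (Real.sin θ * Real.cosh (ν * θ) - Real.cos θ * Real.sinh (ν * θ) / ν),
          fun θ => (ν ^ 2 + 1) / 2 * Real.cosh (ν * θ)] : Fin 4 → ℝ → ℝ) j t) t := by
    intro j t
    fin_cases j
    exacts [hasDerivAt_profileSH₀ hν t, hasDerivAt_profileSH₁ hν t, hasDerivAt_profileSH₂ hν t,
      hasDerivAt_profileSH₀ hν t]
  have hb' : ∀ (j : Fin 4) t, HasDerivAt
      ((![fun θ => (ν ^ 2 + 1) / 2 * Real.cosh (ν * θ),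
          fun θ => (ν ^ 2 + 1) / 2 *
            (Real.cos θ * Real.cosh (ν * θ) + Real.sin θ * Real.sinh (ν * θ) / ν),
          fun θ => (ν ^ 2 + 1) / 2 *
            (Real.sin θ * Real.cosh (ν * θ) - Real.cos θ * Real.sinh (ν * θ) / ν),
          fun θ => (ν ^ 2 + 1) / 2 * Real.cosh (ν * θ)] : Fin 4 → ℝ → ℝ) j)
      ((![fun θ => ν * (ν ^ 2 + 1) / 2 * Real.sinh (ν * θ),
          fun θ => (ν ^ 2 + 1) ^ 2 / (2 * ν) * (Real.cos θ * Real.sinh (ν * θ)),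
          fun θ => (ν ^ 2 + 1) ^ 2 / (2 * ν) * (Real.sin θ * Real.sinh (ν * θ)),
          fun θ => ν * (ν ^ 2 + 1) / 2 * Real.sinh (ν * θ)] : Fin 4 → ℝ → ℝ) j t) t := by
    intro j t
    fin_cases j
    exacts [hasDerivAt_deriv_profileSH₀ t, hasDerivAt_deriv_profileSH₁ hν t,
      hasDerivAt_deriv_profileSH₂ hν t, hasDerivAt_deriv_profileSH₀ t]
  rw [pullback_paramSH, partialDeriv_zero_separated ha hb, partialDeriv_one_separated ha hb,
    partialDeriv_zero_separated ha' hb, partialDeriv_one_separated ha hb']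
  exact ⟨rfl, rfl, rfl, rfl⟩

/-- The coordinates (s, θ) are isothermal: in the rotating frame the cosh part of the planar
velocity cancels the time-like contribution to the θθ coefficient, and the sinh part that is left
equals P². -/
theorem firstFF_pullback_paramSH (w : EuclideanSpace ℝ (Fin 2)) :
    firstFF (DCStructure.pullback (fSHTilde ν) (paramSH ν hε)) w 0 0 = profileSH₀ ν (w 1) ^ 2 ∧
    firstFF (DCStructure.pullback (fSHTilde ν) (paramSH ν hε)) w 0 1 = 0 ∧
    firstFF (DCStructure.pullback (fSHTilde ν) (paramSH ν hε)) w 1 1 = profileSH₀ ν (w 1) ^ 2 := by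
  obtain ⟨h0, h1, -, -⟩ := partialDeriv_pullback_paramSH hν hε
  have hs := Real.cosh_sq (w 0)
  have hθ := Real.cosh_sq (ν * w 1)
  have ht := Real.sin_sq_add_cos_sq (w 1)
  simp only [firstFF, h0, h1, lorentz, separated, Matrix.cons_val, profileSH₀]
  generalize Real.cosh (w 0) = c at *
  generalize Real.sinh (w 0) = s at *
  generalize Real.cosh (ν * w 1) = C at *
  generalize Real.sinh (ν * w 1) = S at *
  generalize Real.cos (w 1) = x at *
  generalize Real.sin (w 1) = y at *
  refine ⟨?_, ?_, ?_⟩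
  · linear_combination ((ν ^ 2 + 1) * S / (2 * ν)) ^ 2 * (ε ^ 2 * hs + hε)
  · ring
  · have : ((ν ^ 2 + 1) / 2 * (x * C + y * S / ν)) ^ 2 + ((ν ^ 2 + 1) / 2 * (y * C - x * S / ν)) ^ 2
        = ((ν ^ 2 + 1) / 2) ^ 2 * (C ^ 2 + S ^ 2 / ν ^ 2) := by
      linear_combination ((ν ^ 2 + 1) / 2) ^ 2 * (C ^ 2 + S ^ 2 / ν ^ 2) * ht
    have e : ((ν ^ 2 + 1) * S / (2 * ν)) ^ 2 = ((ν ^ 2 + 1) / 2) ^ 2 * (S ^ 2 / ν ^ 2) := by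
      field_simp
    rw [e]
    linear_combination this - ((ν ^ 2 + 1) / 2 * C) ^ 2 * (ε ^ 2 * hs + hε)

/-- With α = cP, the three relations are, in order, orthogonality to ∂_θ, norm -1 and orthogonality
to the position vector, after s and the rotation by θ have been eliminated. -/
theorem normalSH_paramSH {w : EuclideanSpace ℝ (Fin 2)} (hw : w 1 ≠ 0) :
    ∃ α u : ℝ, normalSH ν (paramSH ν hε w) = !₂[α * (ε * Real.cosh (w 0)),
        u * Real.cos (w 1) - Real.cosh (ν * w 1) * Real.sin (w 1),
        u * Real.sin (w 1) + Real.cosh (ν * w 1) * Real.cos (w 1), α * (ε * Real.sinh (w 0))] ∧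
      u = α + Real.sinh (ν * w 1) / ν ∧
      -α ^ 2 + u ^ 2 + Real.cosh (ν * w 1) ^ 2 = -1 ∧
      -(α * profileSH₀ ν (w 1)) + u * ((ν ^ 2 - 1) / (2 * ν) * Real.sinh (ν * w 1)) -
        Real.cosh (ν * w 1) ^ 2 = 0 := by
  have hS := sinh_mul_ne_zero hν hw
  have hk : ν ^ 2 + 1 ≠ 0 := by positivity
  have e1 : (ε * Real.exp (w 0) * profileSH₀ ν (w 1) + ε * Real.exp (-w 0) *
      profileSH₀ ν (w 1)) / 2 = ε * Real.cosh (w 0) * profileSH₀ ν (w 1) := by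
    rw [Real.cosh_eq]; ring
  have e2 : (ε * Real.exp (w 0) * profileSH₀ ν (w 1) - ε * Real.exp (-w 0) *
      profileSH₀ ν (w 1)) / 2 = ε * Real.sinh (w 0) * profileSH₀ ν (w 1) := by
    rw [Real.sinh_eq]; ring
  refine ⟨((ν ^ 2 - 1) / (2 * ν) * Real.sinh (ν * w 1) ^ 2 - ν * Real.cosh (ν * w 1) ^ 2) /
    Real.sinh (ν * w 1), ((ν ^ 2 + 1) / (2 * ν) * Real.sinh (ν * w 1) ^ 2 -
    ν * Real.cosh (ν * w 1) ^ 2) / Real.sinh (ν * w 1), ?_, ?_, ?_, ?_⟩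
  · ext j
    fin_cases j
    · simp only [normalSH, paramSH, Matrix.cons_val, Fin.zero_eta, e1]
      rw [profileSH₀]
      field_simp
    · rfl
    · rfl
    · simp only [normalSH, paramSH, Matrix.cons_val, Fin.reduceFinMk, e2]
      rw [profileSH₀]
      field_simp
  · field_simp
    ring
  · rw [Real.cosh_sq]
    field_simp
    ring
  · rw [Real.cosh_sq, profileSH₀]
    field_simp
    ring

theorem isUnitNormal_normalSH {w : EuclideanSpace ℝ (Fin 2)} (hw : w 1 ≠ 0) :
    IsUnitNormal (DCStructure.pullback (fSHTilde ν) (paramSH ν hε))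
      (normalSH ν (paramSH ν hε w)) w := by
  obtain ⟨h0, h1, -, -⟩ := partialDeriv_pullback_paramSH hν hε
  obtain ⟨α, u, hn, hu, hα, hF⟩ := normalSH_paramSH hν hε hw
  have hs := Real.cosh_sq (w 0)
  have ht := Real.cos_sq_add_sin_sq (w 1)
  rw [hn, IsUnitNormal, Fin.forall_fin_two, h0, h1, pullback_paramSH]
  simp only [lorentz, separated, Matrix.cons_val]
  refine ⟨?_, ?_, ?_, ?_⟩
  · linear_combination hα - α ^ 2 * (ε ^ 2 * hs + hε) + (u ^ 2 + Real.cosh (ν * w 1) ^ 2) * ht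
  · rw [profileSH₁, profileSH₂]
    linear_combination hF - α * profileSH₀ ν (w 1) * (ε ^ 2 * hs + hε) +
      (u * ((ν ^ 2 - 1) / (2 * ν) * Real.sinh (ν * w 1)) - Real.cosh (ν * w 1) ^ 2) * ht
  · ring
  · linear_combination (ν ^ 2 + 1) / 2 * Real.cosh (ν * w 1) * hu -
      α * ((ν ^ 2 + 1) / 2 * Real.cosh (ν * w 1)) * (ε ^ 2 * hs + hε) +
      (ν ^ 2 + 1) / 2 * Real.cosh (ν * w 1) * (u - Real.sinh (ν * w 1) / ν) * ht

/-- In isothermal coordinates twice the mean curvature is the pairing of f_ss + f_θθ with the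
normal, divided by P². The outer and planar parts of f_ss + f_θθ share the coefficient (ν² +
1)²/(2ν) sinh(νθ), so the pairing is this times u - α = sinh(νθ)/ν, which is 2P². -/
theorem meanCurvature_normalSH {w : EuclideanSpace ℝ (Fin 2)} (hw : w 1 ≠ 0) :
    meanCurvature (DCStructure.pullback (fSHTilde ν) (paramSH ν hε))
      (normalSH ν (paramSH ν hε w)) w = 1 := by
  obtain ⟨-, -, h00, h11⟩ := partialDeriv_pullback_paramSH hν hε
  obtain ⟨g00, g01, g11⟩ := firstFF_pullback_paramSH hν hε w
  obtain ⟨α, u, hn, hu, -, -⟩ := normalSH_paramSH hν hε hw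
  have hP := profileSH₀_ne_zero hν hw
  have key : secondFF (DCStructure.pullback (fSHTilde ν) (paramSH ν hε))
      (normalSH ν (paramSH ν hε w)) w 0 0 + secondFF (DCStructure.pullback (fSHTilde ν)
      (paramSH ν hε)) (normalSH ν (paramSH ν hε w)) w 1 1 = 2 * profileSH₀ ν (w 1) ^ 2 := by
    have hs := Real.cosh_sq (w 0)
    have ht := Real.cos_sq_add_sin_sq (w 1)
    rw [hn]
    simp only [secondFF, h00, h11, lorentz, separated, Matrix.cons_val, profileSH₀]
    generalize Real.cosh (ν * w 1) = C at *
    generalize Real.sinh (ν * w 1) = S at *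
    have hu' : (ν ^ 2 + 1) ^ 2 / (2 * ν) * S * (u - α) = 2 * ((ν ^ 2 + 1) * S / (2 * ν)) ^ 2 := by
      rw [hu]
      field_simp
      ring
    have e : (ν ^ 2 + 1) ^ 2 / (2 * ν) = (ν ^ 2 + 1) / (2 * ν) + ν * (ν ^ 2 + 1) / 2 := by
      field_simp
      ring
    have e' : (ν ^ 2 + 1) * S / (2 * ν) = (ν ^ 2 + 1) / (2 * ν) * S := by ring
    linear_combination hu' + (ν ^ 2 + 1) ^ 2 / (2 * ν) * S * u * ht + α * S * e -
      α * ((ν ^ 2 + 1) / (2 * ν) * S + ν * (ν ^ 2 + 1) / 2 * S) * (ε ^ 2 * hs + hε)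
  rw [meanCurvature, firstFFDet, g00, g01, g11, div_eq_one_iff_eq]
  · linear_combination profileSH₀ ν (w 1) ^ 2 * key
  · simp [hP]
end

/-! ### The points where the induced metric is nondegenerate -/

theorem exists_sign_mul_pos {ν : ℝ} (hν : 0 < ν) {x : EuclideanSpace ℝ (Fin 3)} (hx : x ∈ XSH ν)
    (h : x 2 ≠ 0) : ∃ ε : ℝ, ε ^ 2 = 1 ∧ 0 < ε * profileSH₀ ν (x 2) * x 0 := by
  have hP := profileSH₀_ne_zero hν h
  have h0 : x 0 ≠ 0 := by
    intro h0
    rw [mem_XSH, h0, zero_mul] at hx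
    exact hP (by simpa using hx.symm)
  rcases lt_or_gt_of_ne (mul_ne_zero hP h0) with h' | h'
  · exact ⟨-1, by norm_num, by linarith⟩
  · exact ⟨1, by norm_num, by linarith⟩

/-- For fixed θ ≠ 0 the set ξη = P(θ)² is a hyperbola with two branches; ε selects the branch and s
runs along it. -/
theorem exists_paramSH_eq {ν : ℝ} (hν : 0 < ν) {p : XSH ν} (h : p.1 2 ≠ 0) :
    ∃ (ε : ℝ) (hε : ε ^ 2 = 1), ∃ w, w 1 = p.1 2 ∧ paramSH ν hε w = p := by
  obtain ⟨ε, hε, hpos⟩ := exists_sign_mul_pos hν p.2 h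
  have hp := mem_XSH.1 p.2
  have hP := profileSH₀_ne_zero hν h
  have hε0 : ε ≠ 0 := by
    rintro rfl
    norm_num at hε
  -- This is e^s, obtained by solving ε e^s P(θ) = ξ and using ε² = 1.
  set r := ε * p.1 0 / profileSH₀ ν (p.1 2) with hr
  have hr0 : 0 < r := by
    have : r = ε * profileSH₀ ν (p.1 2) * p.1 0 / profileSH₀ ν (p.1 2) ^ 2 := by
      rw [hr]
      field_simp
    rw [this]
    positivity
  have e0 : ε * r * profileSH₀ ν (p.1 2) = p.1 0 := by
    rw [hr]
    field_simp
    linear_combination p.1 0 * hε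
  have hr1 : r * r⁻¹ = 1 := mul_inv_cancel₀ hr0.ne'
  refine ⟨ε, hε, !₂[Real.log r, p.1 2], rfl, Subtype.ext ?_⟩
  ext j
  fin_cases j
  · simp [paramSH, Real.exp_log hr0, e0]
  · have h1 : p.1 0 ≠ 0 := by
      rw [← e0]
      positivity
    simp only [paramSH, Matrix.cons_val, Fin.mk_one, Real.exp_neg, Real.exp_log hr0]
    apply mul_left_cancel₀ h1
    rw [hp]
    nth_rw 1 [← e0]
    linear_combination profileSH₀ ν (p.1 2) ^ 2 * ε ^ 2 * hr1 + profileSH₀ ν (p.1 2) ^ 2 * hε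
  · rfl

/-- At θ = 0, differentiating ξη = P(θ)² gives ξ dη + η dξ = 0 with ξη = 0. Away from the vertex
just one of ξ, η vanishes, and so does its differential; hence -dx₀² + dx₃² = -dξ dη is zero and the
metric is a multiple of dθ². -/
theorem firstFFDet_pullback_eq_zero {ν : ℝ} (hν : 0 < ν) {W : Set (EuclideanSpace ℝ (Fin 2))}
    {σ : EuclideanSpace ℝ (Fin 2) → XSH ν} (hσ : (structureSH hν).IsLocalParam W σ)
    {w : EuclideanSpace ℝ (Fin 2)} (hw : w ∈ W) (h2 : (σ w).1 2 = 0) :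
    firstFFDet (DCStructure.pullback (fSHTilde ν) σ) w = 0 := by
  obtain ⟨⟨-, -, han⟩, hdc, -⟩ := hσ
  have hσ0 : (σ w).1 ≠ 0 := fun h => hdc hw ((mem_dcPoints_structureSH hν).2 h)
  have hy : AnalyticAt ℝ (fun w => (σ w).1) w := by
    have h := (analyticAt_ofConeSH ν _).comp (han _ rfl w ⟨hw, mem_univ _⟩)
    refine h.congr (Eventually.of_forall fun v => ?_)
    exact ofConeSH_toConeSH hν _
  have hd : ∀ i, HasFDerivAt (fun w => (σ w).1 i) (fderiv ℝ (fun w => (σ w).1 i) w) w :=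
    fun i => (analyticAt_euclidean.1 hy i).differentiableAt.hasFDerivAt
  set D := fun i => fderiv ℝ (fun w => (σ w).1 i) w with hD
  have hrel : (σ w).1 0 • D 1 + (σ w).1 1 • D 0 = 0 := by
    have hl := (hd 0).mul (hd 1)
    have hr := ((hasDerivAt_profileSH₀ hν _).comp_hasFDerivAt w (hd 2)).pow 2
    have he : (fun w => (σ w).1 0 * (σ w).1 1) = fun w => (profileSH₀ ν ((σ w).1 2)) ^ 2 :=
      funext fun v => mem_XSH.1 (σ v).2
    have hr' : HasFDerivAt (fun w => (σ w).1 0 * (σ w).1 1) _ w := he ▸ hr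
    have := hl.unique hr'
    rw [hD]
    simp only
    rw [this]
    ext v
    simp [h2, profileSH₀_zero]
  have hP : DCStructure.pullback (fSHTilde ν) σ = fun w => ambientSH ν (σ w).1 := rfl
  have hpd : ∀ i j, partialDeriv i (DCStructure.pullback (fSHTilde ν) σ) w j =
      fderiv ℝ (fun w => ambientSH ν (σ w).1 j) w (EuclideanSpace.single i 1) := by
    intro i j
    have hA : DifferentiableAt ℝ (DCStructure.pullback (fSHTilde ν) σ) w := by
      rw [hP]
      exact ((analyticAt_ambientSH ν _).comp hy).differentiableAt
    have h := (EuclideanSpace.proj (𝕜 := ℝ) j).hasFDerivAt.comp w hA.hasFDerivAt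
    exact (congrArg (fun L => L (EuclideanSpace.single i 1)) h.fderiv).symm
  have h0 : HasFDerivAt (fun w => ambientSH ν (σ w).1 0) ((2 : ℝ)⁻¹ • (D 0 + D 1)) w := by
    refine (((hd 0).add (hd 1)).const_mul (2 : ℝ)⁻¹).congr_of_eventuallyEq
      (Eventually.of_forall fun v => ?_)
    simp [ambientSH]
    ring
  have h3 : HasFDerivAt (fun w => ambientSH ν (σ w).1 3) ((2 : ℝ)⁻¹ • (D 0 - D 1)) w := by
    refine (((hd 0).sub (hd 1)).const_mul (2 : ℝ)⁻¹).congr_of_eventuallyEq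
      (Eventually.of_forall fun v => ?_)
    simp [ambientSH]
    ring
  have hg1 := (hasDerivAt_profileSH₁ hν _).comp_hasFDerivAt w (hd 2)
  have hg2 := (hasDerivAt_profileSH₂ hν _).comp_hasFDerivAt w (hd 2)
  have h1 : HasFDerivAt (fun w => ambientSH ν (σ w).1 1) _ w := hg1
  have h2' : HasFDerivAt (fun w => ambientSH ν (σ w).1 2) _ w := hg2
  have hp := mem_XSH.1 (σ w).2
  rw [h2, profileSH₀_zero] at hp
  have hD01 : D 0 = 0 ∨ D 1 = 0 := by
    rcases mul_eq_zero.1 (hp.trans (zero_pow two_ne_zero)) with h | h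
    · left
      have h' : (σ w).1 1 ≠ 0 := by
        intro h'
        apply hσ0
        ext i
        fin_cases i
        exacts [h, h', h2]
      rw [h, zero_smul, zero_add] at hrel
      exact (smul_eq_zero.1 hrel).resolve_left h'
    · right
      have h' : (σ w).1 0 ≠ 0 := by
        intro h'
        apply hσ0
        ext i
        fin_cases i
        exacts [h', h, h2]
      rw [h, zero_smul, add_zero] at hrel
      exact (smul_eq_zero.1 hrel).resolve_left h'
  simp only [firstFFDet, firstFF, lorentz, hpd, h0.fderiv, h1.fderiv, h2'.fderiv, h3.fderiv]
  rcases hD01 with h | h <;> simp [h] <;> ring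

theorem nondegeneratePoints_fSHTilde {ν : ℝ} (hν : 0 < ν) :
    (structureSH hν).nondegeneratePoints (fSHTilde ν) = {p | p.1 2 ≠ 0} := by
  ext p
  constructor
  · rintro ⟨W, σ, hσ, w, hw, rfl, hdet⟩ h
    exact hdet (firstFFDet_pullback_eq_zero hν hσ hw h)
  · intro h
    obtain ⟨ε, hε, w, hw, rfl⟩ := exists_paramSH_eq hν h
    refine ⟨_, _, isLocalParam_paramSH hν hε, w, h, rfl, ?_⟩
    obtain ⟨g00, g01, g11⟩ := firstFF_pullback_paramSH hν hε w
    rw [firstFFDet, g00, g01, g11]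
    have hP : profileSH₀ ν (w 1) ≠ 0 := profileSH₀_ne_zero hν h
    simpa using hP

theorem isSpacelikeCMC1On_fSHTilde {ν : ℝ} (hν : 0 < ν) :
    (structureSH hν).IsSpacelikeCMC1On (fSHTilde ν) {p | p.1 2 ≠ 0} := by
  refine ⟨isOpen_ne_fun (by fun_prop) (by fun_prop), ?_, fun p => normalSH ν p,
    continuousOn_normalSH hν, ?_⟩
  · intro p hp h
    rw [mem_dcPoints_structureSH hν] at h
    exact hp (by rw [h]; rfl)
  · intro p h
    obtain ⟨ε, hε, w, hw, rfl⟩ := exists_paramSH_eq hν h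
    have hP : profileSH₀ ν (w 1) ≠ 0 := profileSH₀_ne_zero hν h
    obtain ⟨g00, g01, g11⟩ := firstFF_pullback_paramSH hν hε w
    refine ⟨_, _, isLocalParam_paramSH hν hε, w, h, rfl, ?_, ?_, isUnitNormal_normalSH hν hε h,
      meanCurvature_normalSH hν hε h⟩
    · rw [g00]
      positivity
    · rw [firstFFDet, g00, g01, g11]
      simp only [ne_eq, OfNat.ofNat_ne_zero, not_false_eq_true, zero_pow, sub_zero]
      positivity

/-- On the cone, a point with a₁ = 0 is the limit as t → 0 of (a₀, t, ε√(a₀² + t²)), where ε chooses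
the nappe. This covers the vertex too. -/
theorem dense_regularPart {ν : ℝ} (hν : 0 < ν) : Dense {p : XSH ν | p.1 2 ≠ 0} := by
  intro p
  by_cases h2 : p.1 2 = 0
  swap
  · exact subset_closure h2
  have hp := mem_XSH.1 p.2
  rw [h2, profileSH₀_zero] at hp
  obtain ⟨ε, hε, h1⟩ : ∃ ε : ℝ, ε ^ 2 = 1 ∧
      (p.1 0 + p.1 1) / 2 = ε * √(((p.1 0 - p.1 1) / 2) ^ 2) := by
    rw [Real.sqrt_sq_eq_abs]
    have h : |(p.1 0 + p.1 1) / 2| = |(p.1 0 - p.1 1) / 2| := by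
      rw [← sq_eq_sq_iff_abs_eq_abs]
      linear_combination hp
    rw [← h]
    rcases abs_choice ((p.1 0 + p.1 1) / 2) with h' | h'
    · exact ⟨1, by norm_num, by rw [h', one_mul]⟩
    · exact ⟨-1, by norm_num, by rw [h']; ring⟩
  let a : ℝ → doubleCone 2 := fun t => ⟨!₂[(p.1 0 - p.1 1) / 2, t,
      ε * √(((p.1 0 - p.1 1) / 2) ^ 2 + t ^ 2)], by
    rw [mem_doubleCone_two]
    simp only [Matrix.cons_val]
    rw [mul_pow, Real.sq_sqrt (by positivity), hε, one_mul]⟩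
  have ha : Continuous a := by
    refine Continuous.subtype_mk ((PiLp.continuous_toLp 2 _).comp (continuous_pi fun j => ?_)) _
    fin_cases j <;> simp <;> fun_prop
  have ha0 : (coneHomeoSH hν).symm (a 0) = p := by
    rw [Homeomorph.symm_apply_eq]
    refine Subtype.ext ?_
    ext j
    fin_cases j
    · rfl
    · change (0 : ℝ) = profileSH₀ ν (p.1 2)
      rw [h2, profileSH₀_zero]
    · change ε * √(((p.1 0 - p.1 1) / 2) ^ 2 + 0 ^ 2) = (p.1 0 + p.1 1) / 2
      rw [h1]
      simp
  have hc : Tendsto (fun t => (coneHomeoSH hν).symm (a t)) (𝓝[≠] 0) (𝓝 p) := by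
    rw [← ha0]
    exact ((coneHomeoSH hν).symm.continuous.comp ha).continuousAt.continuousWithinAt
  refine mem_closure_of_tendsto hc ?_
  filter_upwards [self_mem_nhdsWithin] with t ht h
  apply ht
  have h' : profileInvSH₀ ν t = 0 := h
  change t = 0
  rw [← profileSH₀_profileInvSH₀ hν t, h', profileSH₀_zero]

/-! ### The analytic extension -/

theorem fSHTilde_comp_paramSH (ν : ℝ) (w : EuclideanSpace ℝ (Fin 2)) :
    fSHTilde ν (paramSH ν (one_pow 2) w) = fSH ν w := by
  refine Subtype.ext ((congrFun (pullback_paramSH (ν := ν) (one_pow 2)) w).trans ?_)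
  ext j
  fin_cases j <;> simp [separated, fSH]

theorem isAnalyticExtension_fSHTilde {ν : ℝ} (hν : 0 < ν) :
    (structureSH hν).IsAnalyticExtension (fSHTilde ν) (fSH ν) := by
  have hcomp : fSH ν = fSHTilde ν ∘ paramSH ν (one_pow 2) :=
    funext fun w => (fSHTilde_comp_paramSH ν w).symm
  refine ⟨?_, isDCAnalytic_fSHTilde hν,
    ⟨_, isAnalyticInto_paramSH hν (one_pow 2) isOpen_univ, hcomp⟩, ?_, ?_⟩
  · intro w _
    rw [analyticAt_euclidean]
    intro j
    fin_cases j <;> simp [fSH] <;> fun_prop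
  · rw [hcomp]
    exact range_comp_subset_range _ _
  · intro h
    -- The missing points lie over θ = 0, which `fSH` collapses to one point. At this one x₀ = x₃ =
    -- 1/2, whereas x₀² - x₃² = P² on the image of `fSH` would force P = 0 and hence x₀ = 0.
    have hx : (!₂[1, 0, 0] : EuclideanSpace ℝ (Fin 3)) ∈ XSH ν := by
      simp [mem_XSH, profileSH₀_zero]
    obtain ⟨w, hw⟩ := h ⟨⟨_, hx⟩, rfl⟩
    have h0 : Real.cosh (w 0) * profileSH₀ ν (w 1) = (1 + 0) / 2 :=
      congrArg (fun y : deSitter => y.1 0) hw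
    have h3 : Real.sinh (w 0) * profileSH₀ ν (w 1) = (1 - 0) / 2 :=
      congrArg (fun y : deSitter => y.1 3) hw
    have hs := Real.cosh_sq (w 0)
    have h4 : profileSH₀ ν (w 1) ^ 2 = 0 := by
      linear_combination (Real.cosh (w 0) * profileSH₀ ν (w 1) + 1 / 2) * h0 -
        (Real.sinh (w 0) * profileSH₀ ν (w 1) + 1 / 2) * h3 - profileSH₀ ν (w 1) ^ 2 * hs
    rw [pow_eq_zero_iff two_ne_zero] at h4
    rw [h4] at h0
    norm_num at h0

/-! ### Straightening the immersion -/

/-- The analytic inverse function theorem, with source and target shrunk so that the two maps are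
mutually inverse between S and V and S stays in the prescribed neighbourhood. -/
theorem AnalyticAt.exists_local_inverse {f : ℝ → ℝ} {x : ℝ} (hf : AnalyticAt ℝ f x)
    (hf' : deriv f x ≠ 0) {U : Set ℝ} (hU : U ∈ 𝓝 x) :
    ∃ (S V : Set ℝ) (g : ℝ → ℝ), IsOpen S ∧ IsOpen V ∧ x ∈ S ∧ S ⊆ U ∧ AnalyticOnNhd ℝ g V ∧
      MapsTo f S V ∧ MapsTo g V S ∧ (∀ y ∈ S, g (f y) = y) ∧ ∀ z ∈ V, f (g z) = z := by
  have hs : HasStrictFDerivAt f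
      ((ContinuousLinearEquiv.unitsEquivAut ℝ (Units.mk0 _ hf') : ℝ ≃L[ℝ] ℝ) : ℝ →L[ℝ] ℝ) x :=
    hf.hasStrictDerivAt.hasStrictFDerivAt_equiv hf'
  let e := hs.toOpenPartialHomeomorph f
  have hxe : x ∈ e.source := hs.mem_toOpenPartialHomeomorph_source
  have hg : AnalyticAt ℝ e.symm (f x) := by
    refine e.analyticAt_symm' hxe ?_ hs.hasFDerivAt.fderiv
    exact hf
  have hV : IsOpen (e.target ∩ {z | AnalyticAt ℝ e.symm z}) :=
    e.open_target.inter (isOpen_analyticAt ℝ e.symm)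
  have hV' : IsOpen (e.target ∩ {z | AnalyticAt ℝ e.symm z} ∩ e.symm ⁻¹' interior U) :=
    (e.continuousOn_symm.mono inter_subset_left).isOpen_inter_preimage hV isOpen_interior
  refine ⟨e.source ∩ f ⁻¹' (e.target ∩ {z | AnalyticAt ℝ e.symm z} ∩ e.symm ⁻¹' interior U), _,
    e.symm, e.isOpen_inter_preimage hV', hV', ⟨hxe, ⟨e.map_source hxe, hg⟩, ?_⟩, ?_,
    fun z hz => hz.1.2, fun y hy => hy.2, ?_, fun y hy => e.left_inv hy.1,
    fun z hz => e.right_inv hz.1.1⟩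
  · rw [mem_preimage, show e.symm (f x) = x from e.left_inv hxe]
    exact mem_interior_iff_mem_nhds.2 hU
  · intro y hy
    have h : e.symm (f y) ∈ interior U := hy.2.2
    rw [show e.symm (f y) = y from e.left_inv hy.1] at h
    exact interior_subset h
  · intro z hz
    refine ⟨e.map_target hz.1.1, ?_⟩
    rw [mem_preimage, show f (e.symm z) = z from e.right_inv hz.1.1]
    exact hz

/-- The tangent of the angle from `profileSH θ₀` to the plane vector `(y₁, y₂)`. -/
noncomputable def slopeSH (ν θ₀ y₁ y₂ : ℝ) : ℝ :=
  (profileSH₁ ν θ₀ * y₂ - profileSH₂ ν θ₀ * y₁) / (profileSH₁ ν θ₀ * y₁ + profileSH₂ ν θ₀ * y₂)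

/-- At θ₀ the slope vanishes and its derivative is the determinant of position and velocity over the
squared radius. That determinant is positive: the curve turns about the origin without stopping. -/
theorem deriv_slopeSH_ne_zero {ν : ℝ} (hν : 0 < ν) (θ₀ : ℝ) :
    deriv (fun θ => slopeSH ν θ₀ (profileSH₁ ν θ) (profileSH₂ ν θ)) θ₀ ≠ 0 := by
  have h1 := hasDerivAt_profileSH₁ hν θ₀
  have h2 := hasDerivAt_profileSH₂ hν θ₀
  have hpos : 0 < profileSH₁ ν θ₀ * profileSH₁ ν θ₀ + profileSH₂ ν θ₀ * profileSH₂ ν θ₀ := by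
    nlinarith [profileSH_sq ν θ₀, sq_nonneg (profileSH₀ ν θ₀)]
  have h := ((h2.const_mul (profileSH₁ ν θ₀)).sub (h1.const_mul (profileSH₂ ν θ₀))).div
    ((h1.const_mul (profileSH₁ ν θ₀)).add (h2.const_mul (profileSH₂ ν θ₀))) hpos.ne'
  have h' : HasDerivAt (fun θ => slopeSH ν θ₀ (profileSH₁ ν θ) (profileSH₂ ν θ)) _ θ₀ := h
  rw [h'.deriv]
  have hdet : profileSH₁ ν θ₀ * ((ν ^ 2 + 1) / 2 *
      (Real.sin θ₀ * Real.cosh (ν * θ₀) - Real.cos θ₀ * Real.sinh (ν * θ₀) / ν)) -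
      profileSH₂ ν θ₀ * ((ν ^ 2 + 1) / 2 *
      (Real.cos θ₀ * Real.cosh (ν * θ₀) + Real.sin θ₀ * Real.sinh (ν * θ₀) / ν)) =
      (ν ^ 2 + 1) / 2 * (1 + (ν ^ 2 + 1) / (2 * ν ^ 2) * Real.sinh (ν * θ₀) ^ 2) := by
    have ht := Real.cos_sq' θ₀
    have hc := Real.cosh_sq (ν * θ₀)
    rw [profileSH₁, profileSH₂]
    field_simp
    ring_nf
    simp only [ht, hc]
    ring
  have hpos' : 0 < (ν ^ 2 + 1) / 2 * (1 + (ν ^ 2 + 1) / (2 * ν ^ 2) * Real.sinh (ν * θ₀) ^ 2) := by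
    positivity
  rw [← hdet] at hpos'
  apply div_ne_zero _ (pow_ne_zero 2 hpos.ne')
  simp only [Pi.add_apply, Pi.sub_apply]
  rw [show profileSH₁ ν θ₀ * profileSH₂ ν θ₀ - profileSH₂ ν θ₀ * profileSH₁ ν θ₀ = 0 by ring,
    zero_mul, sub_zero]
  exact mul_ne_zero hpos'.ne' hpos.ne'

/-- Near every point of its image, a real analytic coordinate system of de Sitter space turns
`fSHTilde` into the inclusion of the cone, and the cone is covered by the image. -/
theorem exists_straightening {ν : ℝ} (hν : 0 < ν) (p : XSH ν) :
    ∃ s : Set (XSH ν), IsOpen s ∧ p ∈ s ∧ ∃ Φ : SubmanifoldDiffeo deSitter 3,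
      (∀ b ∈ s, (fSHTilde ν b : EuclideanSpace ℝ (Fin 4)) ∈ Φ.dom ∧
        Φ.toFun (fSHTilde ν b) = toConeSH ν b) ∧
      ∀ a ∈ Φ.cod, a ∈ doubleCone 2 → ∃ b, (fSHTilde ν b : EuclideanSpace ℝ (Fin 4)) = Φ.invFun a := by
  set θ₀ := p.1 2 with hθ₀
  set q₁ := profileSH₁ ν θ₀ with hq₁
  set q₂ := profileSH₂ ν θ₀ with hq₂
  have hq : 0 < q₁ * q₁ + q₂ * q₂ := by
    nlinarith [profileSH_sq ν θ₀, sq_nonneg (profileSH₀ ν θ₀)]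
  have hcont : Continuous fun θ => q₁ * profileSH₁ ν θ + q₂ * profileSH₂ ν θ := by
    unfold profileSH₁ profileSH₂
    fun_prop
  have hT : AnalyticAt ℝ (fun θ => slopeSH ν θ₀ (profileSH₁ ν θ) (profileSH₂ ν θ)) θ₀ := by
    unfold slopeSH
    fun_prop (disch := exact hq.ne')
  obtain ⟨S, V, g, hS, hV, hS0, hSU, hg, hTS, hgV, hgT, hTg⟩ :=
    hT.exists_local_inverse (deriv_slopeSH_ne_zero hν θ₀)
      -- Staying in the open half-plane around the direction (q₁, q₂) ensures that the slope
      -- determines a ray and not merely a line.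
      ((isOpen_lt continuous_const hcont).mem_nhds (x := θ₀) hq)
  have hr : ∀ a : EuclideanSpace ℝ (Fin 3), 0 < 1 + a 1 ^ 2 := fun a => by positivity
  -- The de Sitter equation prescribes x₁² + x₂² = 1 + a₂² - a₀², while the curve point with P = a₁
  -- has squared radius 1 + a₁². The scaling factor between them is `l`, which equals 1 on the cone.
  let l : EuclideanSpace ℝ (Fin 3) → ℝ := fun a => √((1 + a 2 ^ 2 - a 0 ^ 2) / (1 + a 1 ^ 2))
  have hl0 : ∀ a, 0 < 1 + a 2 ^ 2 - a 0 ^ 2 → 0 < l a :=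
    fun a ha => Real.sqrt_pos.2 (div_pos ha (hr a))
  have hl : ∀ a, 0 < 1 + a 2 ^ 2 - a 0 ^ 2 → l a ^ 2 * (1 + a 1 ^ 2) = 1 + a 2 ^ 2 - a 0 ^ 2 := by
    intro a ha
    rw [Real.sq_sqrt (div_pos ha (hr a)).le, div_mul_cancel₀ _ (hr a).ne']
  have hslope : ∀ c y₁ y₂, 0 < c → slopeSH ν θ₀ (c * y₁) (c * y₂) = slopeSH ν θ₀ y₁ y₂ := by
    intro c y₁ y₂ hc
    rw [slopeSH, slopeSH, mul_left_comm _ c, mul_left_comm _ c, mul_left_comm _ c,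
      mul_left_comm _ c, ← mul_sub, ← mul_add, mul_div_mul_left _ _ hc.ne']
  let dom : Set (EuclideanSpace ℝ (Fin 4)) :=
    {x | 0 < q₁ * x 1 + q₂ * x 2} ∩ (fun x => slopeSH ν θ₀ (x 1) (x 2)) ⁻¹' V
  let cod : Set (EuclideanSpace ℝ (Fin 3)) :=
    {a | 0 < 1 + a 2 ^ 2 - a 0 ^ 2} ∩ (fun a => profileInvSH₀ ν (a 1)) ⁻¹' S
  -- Only the direction of (x₁, x₂) is used; `G` recovers the radius through `l`.
  let F : EuclideanSpace ℝ (Fin 4) → EuclideanSpace ℝ (Fin 3) :=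
    fun x => !₂[x 3, profileSH₀ ν (g (slopeSH ν θ₀ (x 1) (x 2))), x 0]
  let G : EuclideanSpace ℝ (Fin 3) → EuclideanSpace ℝ (Fin 4) :=
    fun a => !₂[a 2, l a * profileSH₁ ν (profileInvSH₀ ν (a 1)),
      l a * profileSH₂ ν (profileInvSH₀ ν (a 1)), a 0]
  have hsl : ∀ x : EuclideanSpace ℝ (Fin 4), 0 < q₁ * x 1 + q₂ * x 2 →
      AnalyticAt ℝ (fun x : EuclideanSpace ℝ (Fin 4) => slopeSH ν θ₀ (x 1) (x 2)) x := by
    intro x hx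
    unfold slopeSH
    fun_prop (disch := exact hx.ne')
  have hdom : IsOpen dom := by
    refine ContinuousOn.isOpen_inter_preimage (fun x hx => ?_)
      (isOpen_lt (by fun_prop) (by fun_prop)) hV
    exact (hsl x hx).continuousAt.continuousWithinAt
  have hPinv : Continuous (profileInvSH₀ ν) :=
    continuous_iff_continuousAt.2 fun y => (analyticAt_profileInvSH₀ ν y).continuousAt
  have hcod : IsOpen cod :=
    (isOpen_lt (by fun_prop) (by fun_prop)).inter (hS.preimage (by fun_prop))
  have hF : AnalyticOnNhd ℝ F dom := by
    intro x hx
    have h : AnalyticAt ℝ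
        (fun x : EuclideanSpace ℝ (Fin 4) => g (slopeSH ν θ₀ (x 1) (x 2))) x :=
      AnalyticAt.fun_comp (hg _ hx.2) (hsl x hx.1)
    rw [analyticAt_euclidean]
    intro j
    fin_cases j
    · exact analyticAt_euclidean_apply 3 x
    · exact AnalyticAt.fun_comp (analyticAt_profileSH₀ ν _) h
    · exact analyticAt_euclidean_apply 0 x
  have hG : AnalyticOnNhd ℝ G cod := by
    intro a ha
    have h : AnalyticAt ℝ l a := by
      have h1 : AnalyticAt ℝ
          (fun a : EuclideanSpace ℝ (Fin 3) => (1 + a 2 ^ 2 - a 0 ^ 2) / (1 + a 1 ^ 2)) a := by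
        fun_prop (disch := exact (hr a).ne')
      exact AnalyticAt.fun_comp (Real.contDiffAt_sqrt (div_pos ha.1 (hr a)).ne').analyticAt h1
    rw [analyticAt_euclidean]
    intro j
    fin_cases j <;> simp [G] <;> fun_prop
  have hGθ : ∀ a ∈ cod, profileSH₁ ν (profileInvSH₀ ν (a 1)) ^ 2 +
      profileSH₂ ν (profileInvSH₀ ν (a 1)) ^ 2 = 1 + a 1 ^ 2 := by
    intro a _
    rw [profileSH_sq, profileSH₀_profileInvSH₀ hν]
  have hGslope : ∀ a ∈ cod, g (slopeSH ν θ₀ (G a 1) (G a 2)) = profileInvSH₀ ν (a 1) := by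
    intro a ha
    change g (slopeSH ν θ₀ (l a * _) (l a * _)) = _
    rw [hslope _ _ _ (hl0 a ha.1)]
    exact hgT _ ha.2
  have hleft : ∀ x ∈ deSitter ∩ dom, G (F x) = x := by
    rintro x ⟨hx, hx1, hx2⟩
    set θ := g (slopeSH ν θ₀ (x 1) (x 2)) with hθ
    have hθS : θ ∈ S := hgV hx2
    have hT' : slopeSH ν θ₀ (profileSH₁ ν θ) (profileSH₂ ν θ) = slopeSH ν θ₀ (x 1) (x 2) :=
      hTg _ hx2
    have hθp : 0 < q₁ * profileSH₁ ν θ + q₂ * profileSH₂ ν θ := hSU hθS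
    rw [slopeSH, slopeSH, div_eq_div_iff hθp.ne' hx1.ne'] at hT'
    -- Equal slopes within the half-plane mean that (x₁, x₂) is a positive multiple of the curve
    -- point; `c` is that multiple, and the de Sitter equation identifies it with `l (F x)`.
    set c := (q₁ * x 1 + q₂ * x 2) / (q₁ * profileSH₁ ν θ + q₂ * profileSH₂ ν θ) with hc
    have hc0 : 0 < c := div_pos hx1 hθp
    have hc' : c * (q₁ * profileSH₁ ν θ + q₂ * profileSH₂ ν θ) = q₁ * x 1 + q₂ * x 2 :=
      div_mul_cancel₀ _ hθp.ne'
    have hdet : c * (q₁ * profileSH₂ ν θ - q₂ * profileSH₁ ν θ) = q₁ * x 2 - q₂ * x 1 := by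
      apply mul_right_cancel₀ hθp.ne'
      linear_combination hT' + (q₁ * profileSH₂ ν θ - q₂ * profileSH₁ ν θ) * hc'
    have hc1 : c * profileSH₁ ν θ = x 1 := by
      apply mul_left_cancel₀ hq.ne'
      linear_combination q₁ * hc' - q₂ * hdet
    have hc2 : c * profileSH₂ ν θ = x 2 := by
      apply mul_left_cancel₀ hq.ne'
      linear_combination q₂ * hc' + q₁ * hdet
    have hxl : -(x 0 * x 0) + x 1 * x 1 + x 2 * x 2 + x 3 * x 3 = 1 := hx
    have hlF : l (F x) = c := by
      change √((1 + x 0 ^ 2 - x 3 ^ 2) / (1 + profileSH₀ ν θ ^ 2)) = c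
      rw [Real.sqrt_eq_iff_eq_sq _ hc0.le, div_eq_iff (by positivity), ← profileSH_sq]
      · linear_combination -hxl - (c * profileSH₁ ν θ + x 1) * hc1 -
          (c * profileSH₂ ν θ + x 2) * hc2
      · apply div_nonneg _ (by positivity)
        nlinarith [sq_nonneg (x 1), sq_nonneg (x 2)]
    have hF1 : profileInvSH₀ ν (F x 1) = θ := profileInvSH₀_profileSH₀ hν θ
    ext j
    fin_cases j
    · rfl
    · change l (F x) * profileSH₁ ν (profileInvSH₀ ν (F x 1)) = x 1
      rw [hlF, hF1, hc1]
    · change l (F x) * profileSH₂ ν (profileInvSH₀ ν (F x 1)) = x 2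
      rw [hlF, hF1, hc2]
    · rfl
  let Φ : SubmanifoldDiffeo deSitter 3 :=
    { dom := dom
      cod := cod
      toFun := F
      invFun := G
      isOpen_dom := hdom
      isOpen_cod := hcod
      analytic_toFun := hF
      analytic_invFun := hG
      mapsTo_toFun := by
        rintro x ⟨hx, hx1, hx2⟩
        have hxl : -(x 0 * x 0) + x 1 * x 1 + x 2 * x 2 + x 3 * x 3 = 1 := hx
        constructor
        · change 0 < 1 + x 0 ^ 2 - x 3 ^ 2
          have : x 1 ≠ 0 ∨ x 2 ≠ 0 := by
            by_contra! h
            have hx1' : 0 < q₁ * x 1 + q₂ * x 2 := hx1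
            simp [h.1, h.2] at hx1'
          have : 0 < x 1 ^ 2 + x 2 ^ 2 := by
            rcases this with h | h <;> positivity
          linarith
        · change profileInvSH₀ ν (profileSH₀ ν _) ∈ S
          rw [profileInvSH₀_profileSH₀ hν]
          exact hgV hx2
      mapsTo_invFun := by
        intro a ha
        refine ⟨?_, ?_, ?_⟩
        · change -(a 2 * a 2) + l a * _ * (l a * _) + l a * _ * (l a * _) + a 0 * a 0 = 1
          linear_combination l a ^ 2 * hGθ a ha + hl a ha.1
        · change 0 < q₁ * (l a * _) + q₂ * (l a * _)
          have := mul_pos (hl0 a ha.1) (hSU ha.2)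
          linarith
        · change slopeSH ν θ₀ (l a * _) (l a * _) ∈ V
          rw [hslope _ _ _ (hl0 a ha.1)]
          exact hTS ha.2
      leftInv := hleft
      rightInv := by
        intro a ha
        ext j
        fin_cases j
        · rfl
        · change profileSH₀ ν (g (slopeSH ν θ₀ (G a 1) (G a 2))) = a 1
          rw [hGslope a ha, profileSH₀_profileInvSH₀ hν]
        · rfl }
  refine ⟨(fun b => b.1 2) ⁻¹' S, hS.preimage (by fun_prop), hS0, Φ, ?_, ?_⟩
  · intro b hb
    refine ⟨⟨hSU hb, hTS hb⟩, ?_⟩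
    have : g (slopeSH ν θ₀ (profileSH₁ ν (b.1 2)) (profileSH₂ ν (b.1 2))) = b.1 2 := hgT _ hb
    ext j
    fin_cases j
    · rfl
    · change profileSH₀ ν (g (slopeSH ν θ₀ (profileSH₁ ν (b.1 2)) (profileSH₂ ν (b.1 2)))) =
        profileSH₀ ν (b.1 2)
      rw [this]
    · rfl
  · intro a ha hac
    refine ⟨⟨ofConeSH ν a, ofConeSH_mem_XSH hν hac⟩, ?_⟩
    have hla : l a = 1 := by
      rw [mem_doubleCone_two] at hac
      have : 1 + a 2 ^ 2 - a 0 ^ 2 = 1 + a 1 ^ 2 := by linear_combination -hac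
      simp only [l]
      rw [this, div_self (hr a).ne', Real.sqrt_one]
    ext j
    fin_cases j
    · change (a 2 + a 0 + (a 2 - a 0)) / 2 = a 2
      ring
    · change profileSH₁ ν (profileInvSH₀ ν (a 1)) = l a * _
      rw [hla, one_mul]
    · change profileSH₂ ν (profileInvSH₀ ν (a 1)) = l a * _
      rw [hla, one_mul]
    · change (a 2 + a 0 - (a 2 - a 0)) / 2 = a 0
      ring

theorem isDCImmersion_fSHTilde {ν : ℝ} (hν : 0 < ν) :
    (structureSH hν).IsDCImmersion 3 (fSHTilde ν) := by
  refine ⟨by norm_num, isDCAnalytic_fSHTilde hν, fun p => ?_⟩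
  obtain ⟨s, hs, hp, Φ, hΦ, -⟩ := exists_straightening hν p
  have hsrc : ((coneChartSH hν).restr s).source = s := by
    simp [coneChartSH, hs.interior_eq]
  refine ⟨_, isDCCoordinate_restr hν s, by rwa [hsrc], Φ, fun b hb => ?_⟩
  rw [hsrc] at hb
  refine ⟨(hΦ b hb).1, (hΦ b hb).2.trans ?_⟩
  exact (padZero_self (toConeSH ν b)).symm

/-! ### Analytic completeness -/

theorem isAnalyticallyComplete_range_fSHTilde {ν : ℝ} (hν : 0 < ν) :
    IsAnalyticallyComplete (range (fSHTilde ν)) := by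
  have h0 : (0 : EuclideanSpace ℝ (Fin 3)) ∈ XSH ν := by simp [mem_XSH, profileSH₀_zero]
  refine ⟨⟨_, ⟨0, h0⟩, rfl⟩, ?_⟩
  have : Nonempty (XSH ν) := ⟨⟨0, h0⟩⟩
  rintro Γ ⟨G, hG, hGΓ⟩ ⟨ε, hε0, hε1, hΓε⟩
  set R : Set (EuclideanSpace ℝ (Fin 4)) := Subtype.val '' range (fSHTilde ν) with hR
  have hmem : ∀ t : Icc (0 : ℝ) 1, Γ t ∈ range (fSHTilde ν) ↔ G t ∈ R := by
    intro t
    rw [hGΓ, hR, Subtype.val_injective.mem_set_image]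
  have hdS : ∀ t ∈ Icc (0 : ℝ) 1, G t ∈ deSitter := fun t ht => hGΓ ⟨t, ht⟩ ▸ (Γ ⟨t, ht⟩).2
  have hproper : IsProperMap fun x : XSH ν => (fSHTilde ν x : EuclideanSpace ℝ (Fin 4)) :=
    (isProperMap_ambientSH hν).comp (isClosed_XSH ν).isClosedEmbedding_subtypeVal.isProperMap
  have hRr : R = range fun x : XSH ν => (fSHTilde ν x : EuclideanSpace ℝ (Fin 4)) :=
    (range_comp _ _).symm
  have hRc : IsClosed R := by
    rw [hRr]
    exact hproper.isClosed_range
  -- At an interior time G is analytic on a full neighbourhood, so membership in the image continues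
  -- past T.
  have hstep : ∀ T ∈ Ioo (0 : ℝ) 1, (∀ t ∈ Ico 0 T, G t ∈ R) → ∀ᶠ t in 𝓝 T, G t ∈ R := by
    intro T hT hTR
    have hGT : AnalyticAt ℝ G T := by
      rw [← analyticWithinAt_univ]
      exact (hG T (Ioo_subset_Icc_self hT)).mono_of_mem_nhdsWithin (by
        rw [nhdsWithin_univ]
        exact Icc_mem_nhds hT.1 hT.2)
    choose! x hx using fun t (ht : t ∈ Ico 0 T) => hRr ▸ hTR t ht
    have hlt : ∀ᶠ t in 𝓝[<] T, t ∈ Ico 0 T := Ico_mem_nhdsLT hT.1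
    have hcl : MapClusterPt (G T) (map x (𝓝[<] T))
        (fun x : XSH ν => (fSHTilde ν x : EuclideanSpace ℝ (Fin 4))) := by
      refine Tendsto.mapClusterPt ?_
      rw [tendsto_map'_iff]
      refine (hGT.continuousAt.tendsto.mono_left nhdsWithin_le_nhds).congr' ?_
      filter_upwards [hlt] with t ht
      exact (hx t ht).symm
    obtain ⟨p, hp, hpc⟩ := hproper.clusterPt_of_mapClusterPt hcl
    obtain ⟨s, hs, hps, Φ, hΦ, hΦ'⟩ := exists_straightening hν p
    -- The chosen preimages need not vary continuously and may jump between sheets, so they enter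
    -- `s` only frequently; this suffices for the identity theorem.
    have hfreq : ∃ᶠ t in 𝓝[<] T, x t ∈ s := by
      have := hpc.frequently (hs.mem_nhds hps)
      exact frequently_map.1 this
    have hGd : G T ∈ Φ.dom := hp ▸ (hΦ p hps).1
    have hΦG : AnalyticAt ℝ (fun t => Φ.toFun (G t)) T :=
      AnalyticAt.fun_comp (Φ.analytic_toFun _ hGd) hGT
    have hc := analyticAt_euclidean.1 hΦG
    have hh : AnalyticAt ℝ (fun t => Φ.toFun (G t) 0 ^ 2 + Φ.toFun (G t) 1 ^ 2 -
        Φ.toFun (G t) 2 ^ 2) T := (((hc 0).pow 2).add ((hc 1).pow 2)).sub ((hc 2).pow 2)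
    have hz : ∀ᶠ t in 𝓝 T, Φ.toFun (G t) 0 ^ 2 + Φ.toFun (G t) 1 ^ 2 -
        Φ.toFun (G t) 2 ^ 2 = 0 := by
      rw [← hh.frequently_zero_iff_eventually_zero]
      refine Frequently.filter_mono ?_ (nhdsWithin_mono T fun t (ht : t < T) => ht.ne)
      refine (hfreq.and_eventually hlt).mono ?_
      rintro t ⟨hts, ht⟩
      have h1 := (hΦ _ hts).2
      rw [show (fSHTilde ν (x t) : EuclideanSpace ℝ (Fin 4)) = G t from hx t ht] at h1
      have h2 := toConeSH_mem_doubleCone.2 (x t).2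
      rw [← h1, mem_doubleCone_two] at h2
      exact sub_eq_zero.2 h2
    filter_upwards [hz, hGT.continuousAt.eventually_mem (Φ.isOpen_dom.mem_nhds hGd),
      Icc_mem_nhds hT.1 hT.2] with t ht htd ht01
    have hd : G t ∈ deSitter ∩ Φ.dom := ⟨hdS t ht01, htd⟩
    obtain ⟨b, hb⟩ := hΦ' _ (Φ.mapsTo_toFun hd) (mem_doubleCone_two.2 (sub_eq_zero.1 ht))
    rw [Φ.leftInv _ hd] at hb
    rw [hRr]
    exact ⟨b, hb⟩
  by_contra! ⟨b, hb⟩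
  rw [hmem] at hb
  set B := {t | t ∈ Icc (0 : ℝ) 1 ∧ G t ∉ R} with hB
  have hBne : B.Nonempty := ⟨b, b.2, hb⟩
  have hBbdd : BddBelow B := ⟨0, fun t ht => ht.1.1⟩
  have hεT : ε ≤ sInf B := by
    refine le_csInf hBne fun t ht => ?_
    by_contra! h
    exact ht.2 ((hmem ⟨t, ht.1⟩).1 (hΓε ⟨t, ht.1⟩ h))
  have hT1 : sInf B ≤ 1 := (csInf_le hBbdd ⟨b.2, hb⟩).trans b.2.2
  have hTR : ∀ t ∈ Ico 0 (sInf B), G t ∈ R := by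
    intro t ht
    by_contra h
    exact notMem_of_lt_csInf ht.2 hBbdd ⟨⟨ht.1, ht.2.le.trans hT1⟩, h⟩
  have hT0 : 0 < sInf B := hε0.trans_le hεT
  rcases hT1.lt_or_eq with hT | hT
  -- An infimum of bad times below 1 contradicts continuation beyond it.
  · obtain ⟨c, hc, hcR⟩ := exists_Ico_subset_of_mem_nhds (hstep _ ⟨hT0, hT⟩ hTR) ⟨_, hT⟩
    obtain ⟨t, ht, htc⟩ := exists_lt_of_csInf_lt hBne hc
    exact ht.2 (hcR ⟨csInf_le hBbdd ht, htc⟩)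
  -- If the infimum is 1, only the endpoint could be bad, and closedness of the image excludes it.
  · have hle := csInf_le hBbdd ⟨b.2, hb⟩
    rw [hT] at hle hTR
    rw [le_antisymm b.2.2 hle] at hb
    have hlim : Tendsto G (𝓝[<] 1) (𝓝 (G 1)) := by
      have h := hG.continuousOn 1 (right_mem_Icc.2 zero_le_one)
      refine h.mono_left ?_
      rw [← nhdsWithin_Ico_eq_nhdsLT (zero_lt_one (α := ℝ))]
      exact nhdsWithin_mono _ Ico_subset_Icc_self
    refine hb (hRc.mem_of_tendsto hlim ?_)
    filter_upwards [Ico_mem_nhdsLT (zero_lt_one (α := ℝ))] with t ht using hTR t ht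

theorem mainTheorem9 (ν : ℝ) (hν : 0 < ν) :
    ∃ 𝒜 : DCStructure 2 (XSH ν),
      -- the DC-structure is the one that the inclusion into ℝ³ induces; its DC-point is the origin
      𝒜.IsDCImmersion 3 (inclSH ν) ∧
      Subtype.val '' 𝒜.dcPoints = {(0 : EuclideanSpace ℝ (Fin 3))} ∧
      𝒜.IsSpacelikeCMC1DCImmersion (fSHTilde ν) ∧
      𝒜.IsAnalyticExtension (fSHTilde ν) (fSH ν) ∧
      IsProperMap (fSHTilde ν) ∧
      IsAnalyticallyComplete (Set.range (fSHTilde ν)) := by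
  refine ⟨structureSH hν, isDCImmersion_inclSH hν, image_dcPoints_structureSH hν,
    ⟨connectedSpace_XSH hν, isDCImmersion_fSHTilde hν, ?_, ?_⟩, isAnalyticExtension_fSHTilde hν,
    isProperMap_fSHTilde hν, isAnalyticallyComplete_range_fSHTilde hν⟩
  · rw [nondegeneratePoints_fSHTilde hν]
    exact dense_regularPart hν
  · rw [nondegeneratePoints_fSHTilde hν]
    exact isSpacelikeCMC1On_fSHTilde hν
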